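/- Let $k$ be a field (with the discrete topology), $G$ a profinite group, $H$ a closed subgroup of $G$, and let $k[[G]]=\varprojlim_N k[G/N]$ ($N$ running over the open normal subgroups of $G$) be the completed group algebra. A topological module $U$ over $A=k[[G]]$ (or $A=k[[H]]$, etc.) is called pseudocompact if $0$ has a basis of neighbourhoods consisting of open submodules $V$ of finite $k$-codimension, these intersect in $0$, and $U=\varprojlim_V U/V$. For a closed subgroup $K$ of $G$ write $U{\downarrow_K}$ for the restriction of a $k[[G]]$-module $U$ to $k[[K]]$, and $X{\uparrow^G}=k[[G]]\,\widehat\otimes_{k[[K]]}X$ (completed tensor product) for the module induced from a pseudocompact $k[[K]]$-module $X$. A pseudocompact $k[[G]]$-module $U$ is relatively $K$-projective if for all pseudocompact $k[[G]]$-modules $V,W$, every continuous surjective $k[[G]]$-homomorphism $\beta:V\to W$ and every continuous $k[[G]]$-homomorphism $\varphi:U\to W$: if $\varphi=\beta\psi$ for some continuous $k[[K]]$-homomorphism $\psi:U\to V$, then $\varphi=\beta\psi'$ for some continuous $k[[G]]$-homomorphism $\psi':U\to V$. For $N$ open normal in $G$, $U_N=U/I_NU$ denotes the $k[[G]]$-module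 of $N$-coinvariants, where $I_N$ is the augmentation ideal of $k[[N]]$. For $K$ open in $G$ and a continuous $k[[K]]$-endomorphism $\alpha$ of $U$, put $\mathrm{Tr}_K^G(\alpha)=\sum_{s\in G/K}s\alpha s^{-1}$. Let $U$ be a finitely generated pseudocompact $k[[G]]$-module. The following are equivalent: 1. $U$ is relatively $H$-projective. 2. Every continuous surjective $k[[G]]$-homomorphism $V\to U$, with $V$ a pseudocompact $k[[G]]$-module, that splits as a continuous $k[[H]]$-homomorphism splits as a continuous $k[[G]]$-homomorphism. 3. $U$ is isomorphic to a continuous direct summand of $U{\downarrow_H}{\uparrow^G}$. 4. The natural projection $\pi:U{\downarrow_H}{\uparrow^G}\to U$, $g\,\widehat\otimes\,u\mapsto gu$, splits as a continuous $k[[G]]$-homomorphism. 5. $U$ is isomorphic to a continuous direct summand of $X{\uparrow^G}$ for some pseudocompact $k[[H]]$-module $X$. 6. $U$ is relatively $HN$-projective for every open normal subgroup $N$ of $G$. 7. $U_N$ is relatively $HN$-projective for every open normal subgroup $N$ of $G$. 8. For every open normal subgroup $N$ of $G$ there is a continuous $k[[HN]]$-endomorphism $\alpha_N$ of $U$ with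 $\mathrm{id}_U=\mathrm{Tr}_{HN}^G(\alpha_N)$. -/

import Mathlib

open scoped TensorProduct

universe u

/-! ### Pseudocompact modules -/

section Pseudocompact

variable (k A U : Type u) [Field k] [Ring A] [Algebra k A]
  [AddCommGroup U] [Module k U] [Module A U] [IsScalarTower k A U] [TopologicalSpace U]

/-- The open `A`-submodules of `U` of finite `k`-codimension. -/
def OpenFinSubmodule : Type u :=
  {V : Submodule A U // IsOpen (V : Set U) ∧ FiniteDimensional k (U ⧸ V)}

/-- A topological `A`-module `U` is pseudocompact if `0` has a basis of neighbourhoods consisting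
of open submodules `V` of finite codimension, these intersect in `0`, and `U` is the inverse limit
of the quotients `U ⧸ V`.  (Injectivity of `U → lim U ⧸ V` is `separated`, its surjectivity is
`complete`, and `hasBasis` says that the topology of `U` is that of the limit.) -/
class IsPseudocompactModule : Prop where
  hasBasis : (nhds (0 : U)).HasBasis
    (fun V : Submodule A U => IsOpen (V : Set U) ∧ FiniteDimensional k (U ⧸ V)) (fun V => V)
  separated : ∀ u : U, (∀ V : OpenFinSubmodule k A U, u ∈ V.1) → u = 0
  complete : ∀ x : (∀ V : OpenFinSubmodule k A U, U ⧸ V.1),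
    (∀ (V V' : OpenFinSubmodule k A U) (h : V.1 ≤ V'.1), Submodule.factor h (x V) = x V') →
      ∃ u : U, ∀ V, Submodule.Quotient.mk u = x V

end Pseudocompact

/-- `U` is isomorphic to a continuous direct summand of `W`: there is a submodule of `W`,
the image of a continuous projection, which is topologically isomorphic to `U`. -/
def IsSummand (A : Type u) [Ring A] (U W : Type u)
    [AddCommGroup U] [Module A U] [TopologicalSpace U]
    [AddCommGroup W] [Module A W] [TopologicalSpace W] : Prop :=
  ∃ P : Submodule A W, P.ClosedComplemented ∧ Nonempty (U ≃L[A] P)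

/-! ### The completed tensor product -/

section CompletedTensor

variable {k A B : Type u} [Field k] [Ring A] [Algebra k A] [TopologicalSpace A]
  [Ring B] [Algebra k B]

/-- Pairs of an open two-sided ideal of `A` and an open `B`-submodule of `V`. -/
structure TensorIndex (A B V : Type u) [Ring A] [TopologicalSpace A] [Ring B]
    [AddCommGroup V] [Module B V] [TopologicalSpace V] : Type u where
  ideal : Ideal A
  twoSided : ideal.IsTwoSided
  isOpen_ideal : IsOpen (ideal : Set A)
  sub : Submodule B V
  isOpen_sub : IsOpen (sub : Set V)

variable (f : B →ₐ[k] A) (V : Type u) [AddCommGroup V] [Module k V] [Module B V]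
  [TopologicalSpace V]

/-- The submodule of `A ⊗[k] V` for which the quotient is `(A ⧸ I) ⊗_B (V ⧸ W)`, where `A` is a
right `B`-module through `f`. -/
def tensorRel (p : TensorIndex A B V) : Submodule A (A ⊗[k] V) :=
  Submodule.span A
    ({x | ∃ (a : A) (b : B) (v : V), x = (a * f b) ⊗ₜ[k] v - a ⊗ₜ[k] (b • v)} ∪
      {x | ∃ a ∈ p.ideal, ∃ v : V, x = a ⊗ₜ[k] v} ∪
      {x | ∃ (a : A), ∃ v ∈ p.sub, x = a ⊗ₜ[k] v})

theorem tensorRel_mono {p q : TensorIndex A B V} (hI : p.ideal ≤ q.ideal) (hW : p.sub ≤ q.sub) :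
    tensorRel f V p ≤ tensorRel f V q := by
  refine Submodule.span_mono ?_
  rintro x ((h | ⟨a, ha, v, h⟩) | ⟨a, v, hv, h⟩)
  · exact Or.inl (Or.inl h)
  · exact Or.inl (Or.inr ⟨a, hI ha, v, h⟩)
  · exact Or.inr ⟨a, v, hW hv, h⟩

/-- The module `(A ⧸ I) ⊗_B (V ⧸ W)`. -/
def FinTensor (p : TensorIndex A B V) : Type u := (A ⊗[k] V) ⧸ tensorRel f V p

noncomputable instance (p : TensorIndex A B V) : AddCommGroup (FinTensor f V p) :=
  inferInstanceAs (AddCommGroup ((A ⊗[k] V) ⧸ tensorRel f V p))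

noncomputable instance (p : TensorIndex A B V) : Module A (FinTensor f V p) :=
  inferInstanceAs (Module A ((A ⊗[k] V) ⧸ tensorRel f V p))

/-- The quotient map `A ⊗[k] V → (A ⧸ I) ⊗_B (V ⧸ W)`. -/
noncomputable def FinTensor.mk (p : TensorIndex A B V) : A ⊗[k] V →ₗ[A] FinTensor f V p :=
  (tensorRel f V p).mkQ

/-- The transition map `(A ⧸ I) ⊗_B (V ⧸ W) → (A ⧸ I') ⊗_B (V ⧸ W')` for `I ≤ I'`, `W ≤ W'`. -/
noncomputable def FinTensor.transition {p q : TensorIndex A B V} (hI : p.ideal ≤ q.ideal)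
    (hW : p.sub ≤ q.sub) : FinTensor f V p →ₗ[A] FinTensor f V q :=
  Submodule.factor (tensorRel_mono f V hI hW)

/-- The compatible families in the modules `(A ⧸ I) ⊗_B (V ⧸ W)`. -/
noncomputable def completedTensorSubmodule :
    Submodule A (∀ p : TensorIndex A B V, FinTensor f V p) where
  carrier := {x | ∀ (p q : TensorIndex A B V) (hI : p.ideal ≤ q.ideal) (hW : p.sub ≤ q.sub),
    FinTensor.transition f V hI hW (x p) = x q}
  add_mem' := by
    intro x y hx hy p q hI hW
    simp only [Pi.add_apply, map_add, hx p q hI hW, hy p q hI hW]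
  zero_mem' := by
    intro p q hI hW
    simp only [Pi.zero_apply, map_zero]
  smul_mem' := by
    intro c x hx p q hI hW
    simp only [Pi.smul_apply, map_smul, hx p q hI hW]

/-- The completed tensor product of `A` (a right `B`-module through `f`) and the topological
`B`-module `V`: the inverse limit of the discrete modules `(A ⧸ I) ⊗_B (V ⧸ W)`. -/
def CompletedTensor : Type u := completedTensorSubmodule f V

namespace CompletedTensor

noncomputable instance : AddCommGroup (CompletedTensor f V) :=
  inferInstanceAs (AddCommGroup (completedTensorSubmodule f V))

noncomputable instance : Module A (CompletedTensor f V) :=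
  inferInstanceAs (Module A (completedTensorSubmodule f V))

/-- The component of an element of the inverse limit. -/
noncomputable def proj (p : TensorIndex A B V) : CompletedTensor f V →ₗ[A] FinTensor f V p :=
  (LinearMap.proj p).comp (completedTensorSubmodule f V).subtype

/-- The inverse limit topology, each factor being discrete. -/
noncomputable instance : TopologicalSpace (CompletedTensor f V) :=
  ⨅ p : TensorIndex A B V, TopologicalSpace.induced (proj f V p) ⊥

instance : IsTopologicalAddGroup (CompletedTensor f V) :=
  topologicalAddGroup_iInf fun p => by
    let _ : TopologicalSpace (FinTensor f V p) := ⊥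
    have : DiscreteTopology (FinTensor f V p) := ⟨rfl⟩
    exact topologicalAddGroup_induced (proj f V p)

theorem isOpen_preimage (p : TensorIndex A B V) (s : Set (FinTensor f V p)) :
    IsOpen (proj f V p ⁻¹' s) := by
  have h := iInf_le (fun p : TensorIndex A B V => TopologicalSpace.induced (proj f V p) ⊥) p
  exact h _ ⟨s, trivial, rfl⟩

/-- The pure tensor `a ⊗ v`. -/
noncomputable def tmul (a : A) (v : V) : CompletedTensor f V :=
  ⟨fun p => FinTensor.mk f V p (a ⊗ₜ[k] v), fun _ _ _ _ => rfl⟩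

end CompletedTensor

end CompletedTensor

/-! ### The completed group algebra -/

section CompletedGroupAlgebra

variable (k G : Type u) [Field k] [Group G] [TopologicalSpace G]

/-- The transition map `k[G/M] → k[G/N]` for open normal subgroups `M ≤ N`. -/
noncomputable def groupAlgTransition {M N : OpenNormalSubgroup G}
    (h : M.toSubgroup ≤ N.toSubgroup) :
    MonoidAlgebra k (G ⧸ M.toSubgroup) →ₐ[k] MonoidAlgebra k (G ⧸ N.toSubgroup) :=
  MonoidAlgebra.mapDomainAlgHom k k
    (QuotientGroup.map M.toSubgroup N.toSubgroup (MonoidHom.id G) h)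

/-- The compatible families in the group algebras `k[G/N]`, `N` open normal in `G`. -/
noncomputable def completedGroupSubalgebra :
    Subalgebra k (∀ N : OpenNormalSubgroup G, MonoidAlgebra k (G ⧸ N.toSubgroup)) where
  carrier := {x | ∀ (M N : OpenNormalSubgroup G) (h : M.toSubgroup ≤ N.toSubgroup),
    groupAlgTransition k G h (x M) = x N}
  mul_mem' := by
    intro x y hx hy M N h
    simp only [Pi.mul_apply, map_mul, hx M N h, hy M N h]
  add_mem' := by
    intro x y hx hy M N h
    simp only [Pi.add_apply, map_add, hx M N h, hy M N h]
  algebraMap_mem' := by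
    intro c M N h
    simp only [Pi.algebraMap_apply, AlgHom.commutes]

/-- The completed group algebra `k⟦G⟧ = lim k[G/N]`. -/
def CGA : Type u := completedGroupSubalgebra k G

namespace CGA

noncomputable instance : Ring (CGA k G) := inferInstanceAs (Ring (completedGroupSubalgebra k G))

noncomputable instance : Algebra k (CGA k G) :=
  inferInstanceAs (Algebra k (completedGroupSubalgebra k G))

/-- The projection `k⟦G⟧ → k[G/N]`. -/
noncomputable def proj (N : OpenNormalSubgroup G) :
    CGA k G →ₐ[k] MonoidAlgebra k (G ⧸ N.toSubgroup) :=
  (Pi.evalAlgHom k _ N).comp (completedGroupSubalgebra k G).val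

/-- The inverse limit topology, each `k[G/N]` being discrete. -/
noncomputable instance : TopologicalSpace (CGA k G) :=
  ⨅ N : OpenNormalSubgroup G, TopologicalSpace.induced (proj k G N) ⊥

variable {G}

/-- The canonical image of a group element in `k⟦G⟧`. -/
noncomputable def of : G →* CGA k G where
  toFun g := ⟨fun N => MonoidAlgebra.of k (G ⧸ N.toSubgroup) (QuotientGroup.mk g), by
    intro M N h
    simp [groupAlgTransition]
    rfl⟩
  map_one' := Subtype.ext (funext fun N => by
    change MonoidAlgebra.of k (G ⧸ N.toSubgroup) ((1 : G) : G ⧸ N.toSubgroup) = 1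
    simp [MonoidAlgebra.one_def])
  map_mul' g h := Subtype.ext (funext fun N => by
    change MonoidAlgebra.of k (G ⧸ N.toSubgroup) ((g * h : G) : G ⧸ N.toSubgroup) =
      MonoidAlgebra.of k (G ⧸ N.toSubgroup) (g : G ⧸ N.toSubgroup) *
        MonoidAlgebra.of k (G ⧸ N.toSubgroup) (h : G ⧸ N.toSubgroup)
    rw [← map_mul, QuotientGroup.mk_mul])

/-- The open normal subgroup `H ∩ N` of `H`. -/
def interSubgroup (H : Subgroup G) (N : OpenNormalSubgroup G) : OpenNormalSubgroup H where
  toSubgroup := N.toSubgroup.subgroupOf H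
  isOpen' := N.isOpen'.preimage continuous_subtype_val
  isNormal' := inferInstance

/-- The homomorphism `k[H/(H ∩ N)] → k[G/N]`. -/
noncomputable def interMap (H : Subgroup G) (N : OpenNormalSubgroup G) :
    MonoidAlgebra k (H ⧸ (interSubgroup H N).toSubgroup) →ₐ[k]
      MonoidAlgebra k (G ⧸ N.toSubgroup) :=
  MonoidAlgebra.mapDomainAlgHom k k
    (QuotientGroup.map (interSubgroup H N).toSubgroup N.toSubgroup H.subtype le_rfl)

theorem interMap_transition (H : Subgroup G) {M N : OpenNormalSubgroup G}
    (h : M.toSubgroup ≤ N.toSubgroup)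
    (h' : (interSubgroup H M).toSubgroup ≤ (interSubgroup H N).toSubgroup) :
    (groupAlgTransition k G h).comp (interMap k H M) =
      (interMap k H N).comp (groupAlgTransition k H h') := by
  unfold groupAlgTransition interMap
  rw [← MonoidAlgebra.mapDomainAlgHom_comp, ← MonoidAlgebra.mapDomainAlgHom_comp]
  congr 1
  ext x
  rfl

/-- The homomorphism `k⟦H⟧ → k⟦G⟧` extending the inclusion of the subgroup `H` in `G`. -/
noncomputable def incl (H : Subgroup G) : CGA k H →ₐ[k] CGA k G :=
  AlgHom.codRestrict
    (AlgHom.pi fun N : OpenNormalSubgroup G =>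
      (interMap k H N).comp (proj k H (interSubgroup H N)))
    (completedGroupSubalgebra k G) (by
      intro x M N h
      have h' : (interSubgroup H M).toSubgroup ≤ (interSubgroup H N).toSubgroup :=
        fun a ha => h ha
      have e := DFunLike.congr_fun (interMap_transition k H h h')
        (proj k H (interSubgroup H M) x)
      have e' : groupAlgTransition k H h' (proj k H (interSubgroup H M) x) =
        proj k H (interSubgroup H N) x := x.2 _ _ h'
      simp only [AlgHom.comp_apply] at e
      rw [e'] at e
      exact e)

theorem incl_of (H : Subgroup G) (h : H) : incl k H (of k h) = of k (h : G) := by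
  refine Subtype.ext (funext fun N => ?_)
  change interMap k H N (MonoidAlgebra.of k _ (QuotientGroup.mk h)) =
    MonoidAlgebra.of k _ (QuotientGroup.mk (h : G))
  simp [interMap]
  rfl

variable (G) in
/-- The whole group as an open normal subgroup of itself. -/
def wholeGroup : OpenNormalSubgroup G where
  toSubgroup := ⊤
  isOpen' := isOpen_univ
  isNormal' := inferInstance

variable (G) in
/-- The augmentation `k⟦G⟧ → k`, the continuous homomorphism sending each `g` to `1`. -/
noncomputable def augmentation : CGA k G →ₐ[k] k :=
  (MonoidAlgebra.lift k k (G ⧸ (wholeGroup G).toSubgroup) 1).comp (proj k G (wholeGroup G))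

theorem augmentation_of (g : G) : augmentation k G (of k g) = 1 := by
  change MonoidAlgebra.lift k k (G ⧸ (wholeGroup G).toSubgroup) 1 (MonoidAlgebra.of k _ _) = 1
  simp

end CGA

end CompletedGroupAlgebra

/-! ### Restriction, induction, coinvariants, trace -/

section Restriction

variable (k : Type u) {G : Type u} [Field k] [Group G] [TopologicalSpace G]

/-- The restriction of the `k⟦G⟧`-module `U` to `k⟦H⟧`: the same topological vector space with
scalars restricted along `k⟦H⟧ → k⟦G⟧`. -/
def Res (_k : Type u) {G : Type u} [Group G] (_H : Subgroup G) (U : Type u) : Type u := U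

namespace Res

variable (H : Subgroup G) (U : Type u)

instance [AddCommGroup U] : AddCommGroup (Res k H U) := inferInstanceAs (AddCommGroup U)

instance [TopologicalSpace U] : TopologicalSpace (Res k H U) :=
  inferInstanceAs (TopologicalSpace U)

instance [AddCommGroup U] [Module k U] : Module k (Res k H U) := inferInstanceAs (Module k U)

noncomputable instance [AddCommGroup U] [Module (CGA k G) U] : Module (CGA k H) (Res k H U) :=
  Module.compHom U (CGA.incl k H).toRingHom

/-- The identity map from `U` to its restriction. -/
def mk [AddCommGroup U] : U ≃+ Res k H U := AddEquiv.refl U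

variable {U}

theorem smul_mk [AddCommGroup U] [Module (CGA k G) U] (b : CGA k H) (u : U) :
    b • mk k H U u = mk k H U (CGA.incl k H b • u) := rfl

theorem mk_symm_smul [AddCommGroup U] [Module (CGA k G) U] (b : CGA k H) (u : Res k H U) :
    (mk k H U).symm (b • u) = CGA.incl k H b • (mk k H U).symm u := rfl

end Res

/-- The induced module `X↑^G`, the completed tensor product of `k⟦G⟧` and `X` over `k⟦H⟧`. -/
abbrev Ind (H : Subgroup G) (X : Type u) [AddCommGroup X] [Module k X] [Module (CGA k H) X]
    [TopologicalSpace X] : Type u :=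
  CompletedTensor (CGA.incl k H) X

section NaturalProjection

variable (H : Subgroup G) (U : Type u) [AddCommGroup U] [Module k U] [Module (CGA k G) U]
  [IsScalarTower k (CGA k G) U] [TopologicalSpace U]

/-- The map `k⟦G⟧ ⊗[k] U → U`, `a ⊗ u ↦ a u`. -/
noncomputable def actMap : CGA k G ⊗[k] Res k H U →ₗ[CGA k G] U :=
  TensorProduct.AlgebraTensorModule.lift
    { toFun := fun a =>
        { toFun := fun u => a • (Res.mk k H U).symm u
          map_add' := fun u v => by rw [map_add, smul_add]
          map_smul' := fun c u => smul_comm a c ((Res.mk k H U).symm u) }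
      map_add' := fun a b => LinearMap.ext fun u => add_smul a b ((Res.mk k H U).symm u)
      map_smul' := fun a b => LinearMap.ext fun u => mul_smul a b ((Res.mk k H U).symm u) }

variable {U}

theorem isOpen_annihilator [IsTopologicalAddGroup U] [ContinuousSMul (CGA k G) U]
    (V : OpenFinSubmodule k (CGA k G) U) :
    IsOpen (Module.annihilator (CGA k G) (U ⧸ V.1) : Set (CGA k G)) := by
  have := V.2.2
  obtain ⟨n, s, hs⟩ := Module.Finite.exists_fin (R := k) (M := U ⧸ V.1)
  choose t ht using fun i => Submodule.Quotient.mk_surjective V.1 (s i)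
  have e : (Module.annihilator (CGA k G) (U ⧸ V.1) : Set (CGA k G)) =
      ⋂ i, (fun a : CGA k G => a • t i) ⁻¹' (V.1 : Set U) := by
    ext a
    simp only [SetLike.mem_coe, Module.mem_annihilator, Set.mem_iInter, Set.mem_preimage]
    constructor
    · intro h i
      rw [← Submodule.Quotient.mk_eq_zero, Submodule.Quotient.mk_smul]
      exact h _
    · intro h x
      have hx : x ∈ Submodule.span k (Set.range s) := hs ▸ Submodule.mem_top
      induction hx using Submodule.span_induction with
      | mem x hx =>
        obtain ⟨i, rfl⟩ := hx
        rw [← ht i, ← Submodule.Quotient.mk_smul]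
        exact (Submodule.Quotient.mk_eq_zero _).2 (h i)
      | zero => exact smul_zero _
      | add x y _ _ hx hy => rw [smul_add, hx, hy, add_zero]
      | smul c x _ hx => rw [smul_comm, hx, smul_zero]
  rw [e]
  exact isOpen_iInter_of_finite fun i =>
    V.2.1.preimage (continuous_id.smul continuous_const)

variable [IsTopologicalAddGroup U] [ContinuousSMul (CGA k G) U]

/-- An open submodule `V` of finite codimension in `U`, together with the annihilator of `U ⧸ V`. -/
noncomputable def projIndex (V : OpenFinSubmodule k (CGA k G) U) :
    TensorIndex (CGA k G) (CGA k H) (Res k H U) where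
  ideal := Module.annihilator (CGA k G) (U ⧸ V.1)
  twoSided := inferInstance
  isOpen_ideal := isOpen_annihilator k V
  sub :=
    { carrier := {u | (Res.mk k H U).symm u ∈ V.1}
      add_mem' := fun hu hv => V.1.add_mem hu hv
      zero_mem' := V.1.zero_mem
      smul_mem' := fun _ _ hu => V.1.smul_mem _ hu }
  isOpen_sub := V.2.1

/-- The map `g ⊗ u ↦ g u + V` on a factor of the inverse limit `U↓_H↑^G`. -/
noncomputable def projFactor (V : OpenFinSubmodule k (CGA k G) U) :
    FinTensor (CGA.incl k H) (Res k H U) (projIndex k H V) →ₗ[CGA k G] U ⧸ V.1 :=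
  Submodule.liftQ (tensorRel (CGA.incl k H) (Res k H U) (projIndex k H V))
    (V.1.mkQ.comp (actMap k H U)) (by
      refine Submodule.span_le.2 ?_
      rintro x ((⟨a, b, v, rfl⟩ | ⟨a, ha, v, rfl⟩) | ⟨a, v, hv, rfl⟩)
      · have : actMap k H U ((a * CGA.incl k H b) ⊗ₜ[k] v - a ⊗ₜ[k] (b • v)) = 0 := by
          rw [map_sub, sub_eq_zero]
          exact mul_smul a (CGA.incl k H b) ((Res.mk k H U).symm v)
        simp [this]
      · exact Module.mem_annihilator.1 ha (V.1.mkQ ((Res.mk k H U).symm v))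
      · exact (Submodule.Quotient.mk_eq_zero V.1).2 (V.1.smul_mem a hv))

theorem projFactor_compat (V V' : OpenFinSubmodule k (CGA k G) U) (h : V.1 ≤ V'.1)
    (x : Ind k H (Res k H U)) :
    Submodule.factor h (projFactor k H V (CompletedTensor.proj _ _ (projIndex k H V) x)) =
      projFactor k H V' (CompletedTensor.proj _ _ (projIndex k H V') x) := by
  have hI : (projIndex k H V).ideal ≤ (projIndex k H V').ideal := by
    intro a ha
    refine Module.mem_annihilator.2 fun y => ?_
    obtain ⟨y, rfl⟩ := Submodule.Quotient.mk_surjective V'.1 y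
    have := (Submodule.Quotient.mk_eq_zero V.1).1
      (Module.mem_annihilator.1 ha (Submodule.Quotient.mk y))
    exact (Submodule.Quotient.mk_eq_zero V'.1).2 (h this)
  have hW : (projIndex k H V).sub ≤ (projIndex k H V').sub := fun u hu => h hu
  have hx : FinTensor.transition (CGA.incl k H) (Res k H U) hI hW
      (CompletedTensor.proj _ _ (projIndex k H V) x) =
      CompletedTensor.proj _ _ (projIndex k H V') x := x.2 _ _ hI hW
  rw [← hx]
  obtain ⟨y, hy⟩ := Submodule.mkQ_surjective _
    (CompletedTensor.proj (CGA.incl k H) (Res k H U) (projIndex k H V) x)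
  rw [← hy]
  rfl

variable [IsPseudocompactModule k (CGA k G) U]

theorem exists_naturalProj (x : Ind k H (Res k H U)) :
    ∃ u : U, ∀ V : OpenFinSubmodule k (CGA k G) U, Submodule.Quotient.mk u =
      projFactor k H V (CompletedTensor.proj _ _ (projIndex k H V) x) :=
  IsPseudocompactModule.complete _ fun V V' h => projFactor_compat k H V V' h x

/-- The natural projection `U↓_H↑^G → U`, as a function. -/
noncomputable def naturalProjFun (x : Ind k H (Res k H U)) : U := (exists_naturalProj k H x).choose

theorem mk_naturalProjFun (x : Ind k H (Res k H U)) (V : OpenFinSubmodule k (CGA k G) U) :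
    (Submodule.Quotient.mk (naturalProjFun k H x) : U ⧸ V.1) =
      projFactor k H V (CompletedTensor.proj _ _ (projIndex k H V) x) :=
  (exists_naturalProj k H x).choose_spec V

theorem eq_naturalProjFun (x : Ind k H (Res k H U)) (u : U)
    (h : ∀ V : OpenFinSubmodule k (CGA k G) U, (Submodule.Quotient.mk u : U ⧸ V.1) =
      projFactor k H V (CompletedTensor.proj _ _ (projIndex k H V) x)) :
    naturalProjFun k H x = u :=
  sub_eq_zero.1 (IsPseudocompactModule.separated (k := k) (A := CGA k G) _ fun V =>
    (Submodule.Quotient.eq V.1).1 ((mk_naturalProjFun k H x V).trans (h V).symm))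

variable (U) in
/-- The natural projection `U↓_H↑^G → U`, `g ⊗ u ↦ g u`. -/
noncomputable def naturalProj : Ind k H (Res k H U) →L[CGA k G] U where
  toFun := naturalProjFun k H
  map_add' x y := eq_naturalProjFun k H _ _ fun V => by
    rw [Submodule.Quotient.mk_add, mk_naturalProjFun, mk_naturalProjFun, map_add, map_add]
  map_smul' a x := eq_naturalProjFun k H _ _ fun V => by
    rw [RingHom.id_apply, Submodule.Quotient.mk_smul, mk_naturalProjFun, map_smul, map_smul]
  cont := by
    rw [continuous_iff_continuousAt]
    intro x
    refine tendsto_sub_nhds_zero_iff.1 ?_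
    refine (IsPseudocompactModule.hasBasis (k := k) (A := CGA k G) (U := U)).tendsto_right_iff.2 ?_
    intro V hV
    have hopen := CompletedTensor.isOpen_preimage (CGA.incl k H) (Res k H U)
      (projIndex k H ⟨V, hV⟩) {CompletedTensor.proj _ _ (projIndex k H ⟨V, hV⟩) x}
    filter_upwards [hopen.mem_nhds rfl] with y hy
    refine (Submodule.Quotient.eq V).1 ?_
    refine (mk_naturalProjFun k H y ⟨V, hV⟩).trans
      (Eq.trans ?_ (mk_naturalProjFun k H x ⟨V, hV⟩).symm)
    rw [show _ = _ from hy]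

theorem naturalProj_tmul (a : CGA k G) (u : U) :
    naturalProj k H U (CompletedTensor.tmul (CGA.incl k H) (Res k H U) a (Res.mk k H U u)) =
      a • u :=
  eq_naturalProjFun k H _ _ fun _ => rfl

end NaturalProjection

/-- A homomorphism of `k⟦G⟧`-modules splits. -/
def Splits {A : Type u} [Ring A] {V U : Type u}
    [AddCommGroup V] [Module A V] [TopologicalSpace V]
    [AddCommGroup U] [Module A U] [TopologicalSpace U] (π : V →L[A] U) : Prop :=
  ∃ s : U →L[A] V, ∀ u, π (s u) = u

/-- A homomorphism of `k⟦G⟧`-modules splits as a homomorphism of `k⟦H⟧`-modules. -/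
def SplitsOver (H : Subgroup G) {V U : Type u}
    [AddCommGroup V] [Module (CGA k G) V] [TopologicalSpace V]
    [AddCommGroup U] [Module (CGA k G) U] [TopologicalSpace U] (π : V →L[CGA k G] U) : Prop :=
  ∃ s : Res k H U →L[CGA k H] Res k H V,
    ∀ u : U, π ((Res.mk k H V).symm (s (Res.mk k H U u))) = u

/-- `U` is relatively `H`-projective: a continuous homomorphism `φ : U → W` of `k⟦G⟧`-modules
lifts along a surjection `β : V → W` of pseudocompact modules if it lifts over `k⟦H⟧`. -/
def RelProjective (H : Subgroup G) (U : Type u)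
    [AddCommGroup U] [Module (CGA k G) U] [TopologicalSpace U] : Prop :=
  ∀ (V W : Type u)
    [AddCommGroup V] [Module k V] [Module (CGA k G) V] [IsScalarTower k (CGA k G) V]
    [TopologicalSpace V] [IsTopologicalAddGroup V] [ContinuousSMul (CGA k G) V]
    [IsPseudocompactModule k (CGA k G) V]
    [AddCommGroup W] [Module k W] [Module (CGA k G) W] [IsScalarTower k (CGA k G) W]
    [TopologicalSpace W] [IsTopologicalAddGroup W] [ContinuousSMul (CGA k G) W]
    [IsPseudocompactModule k (CGA k G) W]
    (β : V →L[CGA k G] W) (φ : U →L[CGA k G] W), Function.Surjective β →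
    (∃ ψ : Res k H U →L[CGA k H] Res k H V,
      ∀ u : U, β ((Res.mk k H V).symm (ψ (Res.mk k H U u))) = φ u) →
    ∃ ψ : U →L[CGA k G] V, ∀ u : U, β (ψ u) = φ u

section Coinvariants

variable (N : Subgroup G) (U : Type u) [AddCommGroup U] [Module (CGA k G) U]
  [TopologicalSpace U] [IsTopologicalAddGroup U] [ContinuousSMul (CGA k G) U]

/-- The closed `k⟦G⟧`-submodule of `U` generated by `I_N U`, where `I_N` is the augmentation ideal
of `k⟦N⟧`. -/
noncomputable def augSubmodule : Submodule (CGA k G) U :=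
  (Submodule.span (CGA k G)
    {x : U | ∃ i : CGA k N, CGA.augmentation k N i = 0 ∧
      ∃ u : U, x = CGA.incl k N i • u}).topologicalClosure

/-- The module of coinvariants `U_N = U / I_N U`, for `N` normal in `G`, with the quotient
topology. -/
abbrev Coinvariants : Type u := U ⧸ augSubmodule k N U

end Coinvariants

section Trace

variable (H : Subgroup G) {U W : Type u}
  [AddCommGroup U] [Module (CGA k G) U] [TopologicalSpace U]
  [AddCommGroup W] [Module (CGA k G) W] [TopologicalSpace W]

/-- The value at `u` of `s α s⁻¹`, a function of the coset `s ∈ G/H`. -/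
noncomputable def conjApply (α : Res k H U →L[CGA k H] Res k H W) (u : U) : G ⧸ H → W :=
  Quotient.lift
    (fun s : G => CGA.of k s • (Res.mk k H W).symm (α (Res.mk k H U (CGA.of k s⁻¹ • u))))
    (by
      intro s t hst
      obtain ⟨h, rfl⟩ : ∃ h : H, t = s * h :=
        ⟨⟨s⁻¹ * t, QuotientGroup.leftRel_apply.1 hst⟩, by simp⟩
      have e : Res.mk k H U (CGA.of k (s * h)⁻¹ • u) =
          CGA.of k h⁻¹ • Res.mk k H U (CGA.of k s⁻¹ • u) := by
        rw [Res.smul_mk, CGA.incl_of, smul_smul, ← map_mul, mul_inv_rev]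
        rfl
      simp only [e, map_smul, Res.mk_symm_smul, CGA.incl_of, smul_smul, ← map_mul]
      simp)

/-- The trace `Tr_H^G(α) = ∑_{s ∈ G/H} s α s⁻¹`, for `H` open in the profinite group `G`
(so that `G/H` is finite). -/
noncomputable def traceMap (α : Res k H U →L[CGA k H] Res k H W) (u : U) : W :=
  ∑ᶠ s : G ⧸ H, conjApply k H α u s

end Trace

end Restriction

/-! ### Inverse limit topologies -/

section LimitTopology

variable {ι X Y : Type*} {F : ι → Type*}

/-! The equivalence of relative `H`-projectivity with the splitting and summand conditions is
formal. Induction is left adjoint to restriction (`Ind.exists_lift`), so a lift over `k⟦H⟧` on `X`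
extends to `X↑^G` and restricts to a summand (`IsSummand.relProjective`). Conversely `u ↦ 1 ⊗ u`
splits the natural projection over `k⟦H⟧`, so relative projectivity splits it over `k⟦G⟧`.

The conditions over all `N` form a circle with relative `H`-projectivity. A lift over `HN` is a lift
over `H`, so projectivity passes from `H` up to `HN`. As `HN` is open, the natural projection is the
trace of the map `p` that projects onto the summand of the trivial coset
(`exists_traceMap_eq_naturalProj`); if `s` splits it, then `id = Tr(p s)`. Given `id = Tr(α)`, the
quotient map `q : U → U_N`, and a lift `ψ` over `HN` of some `φ : U_N → W`, the map `Tr(ψ q α)` is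
`k⟦G⟧`-linear, factors through `U_N` and lifts `φ` (`relProjective_coinvariants_of_trace`).

The substantial step returns from the coinvariants to `U`. Modulo an open submodule `V'` of `V` the
lifting problem factors through some `U_N`, so there is a lift to `V ⧸ V'` (`exists_lift_mod`).
These lifts involve choices and need not be compatible. They are glued by a generalized limit along
shrinking `V'`: eventually constant families in `k` have a limit, and it extends linearly to all
families (`exists_generalized_limit`). Applied to functionals on the finite-dimensional quotients of
`V`, this gives a lift to `V` (`exists_lift_of_exists_lift_mod`). Finite generation of `U` makes it
continuous: the closed submodule generated by `Ann(V ⧸ V') U` has finite codimension, hence is open,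
and all the approximate lifts carry it to zero modulo `V'`. -/

theorem continuous_limit_iff [TopologicalSpace Y] (f : ∀ i, X → F i) (g : Y → X) :
    @Continuous Y X _ (⨅ i, TopologicalSpace.induced (f i) ⊥) g ↔
      ∀ i y, ∀ᶠ z in nhds y, f i (g z) = f i (g y) := by
  rw [continuous_iInf_rng]
  refine forall_congr' fun i => ?_
  rw [continuous_induced_rng]
  let _ : TopologicalSpace (F i) := ⊥
  have : DiscreteTopology (F i) := ⟨rfl⟩
  exact ((IsLocallyConstant.iff_continuous _).symm).trans (IsLocallyConstant.iff_eventually_eq _)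

/-- The hypothesis `hf` is directedness expressed through fibres: any two maps are refined by a
third. Hence fibres of single maps suffice, without finite intersections. -/
theorem nhds_limit_hasBasis [Nonempty ι] (f : ∀ i, X → F i)
    (hf : ∀ i j, ∃ l, ∀ x y, f l x = f l y → f i x = f i y ∧ f j x = f j y) (x : X) :
    (@nhds X (⨅ i, TopologicalSpace.induced (f i) ⊥) x).HasBasis (fun _ => True)
      (fun i => {y | f i y = f i x}) := by
  have e : @nhds X (⨅ i, TopologicalSpace.induced (f i) ⊥) x =
      ⨅ i, Filter.principal {y | f i y = f i x} := by
    rw [nhds_iInf]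
    refine iInf_congr fun i => ?_
    let _ : TopologicalSpace (F i) := ⊥
    have : DiscreteTopology (F i) := ⟨rfl⟩
    rw [nhds_induced, nhds_discrete, Filter.comap_pure]
    rfl
  rw [e]
  refine Filter.hasBasis_iInf_principal fun i j => ?_
  obtain ⟨l, hl⟩ := hf i j
  exact ⟨l, fun y hy => (hl y x hy).1, fun y hy => (hl y x hy).2⟩

end LimitTopology

/-! ### The topology of the completed group algebra -/

namespace CGA

variable {k G : Type u} [Field k] [Group G] [TopologicalSpace G]

theorem ext_proj {x y : CGA k G} (h : ∀ N, proj k G N x = proj k G N y) : x = y :=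
  Subtype.ext (funext h)

theorem transition_proj {M N : OpenNormalSubgroup G} (h : M.toSubgroup ≤ N.toSubgroup)
    (x : CGA k G) : groupAlgTransition k G h (proj k G M x) = proj k G N x :=
  x.2 M N h

theorem proj_eq_of_le {M N : OpenNormalSubgroup G} (h : M.toSubgroup ≤ N.toSubgroup)
    {x y : CGA k G} (e : proj k G M x = proj k G M y) : proj k G N x = proj k G N y := by
  rw [← transition_proj h, ← transition_proj h, e]

theorem continuous_iff {Y : Type*} [TopologicalSpace Y] (g : Y → CGA k G) :
    Continuous g ↔ ∀ N y, ∀ᶠ z in nhds y, proj k G N (g z) = proj k G N (g y) :=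
  continuous_limit_iff (fun N => proj k G N) g

instance : Nonempty (OpenNormalSubgroup G) := ⟨wholeGroup G⟩

theorem nhds_hasBasis (x : CGA k G) : (nhds x).HasBasis (fun _ : OpenNormalSubgroup G => True)
    (fun N => {y | proj k G N y = proj k G N x}) :=
  nhds_limit_hasBasis (fun N => proj k G N)
    (fun M N => ⟨M ⊓ N, fun _ _ h => ⟨proj_eq_of_le inf_le_left h, proj_eq_of_le inf_le_right h⟩⟩) x

theorem eventually_proj_eq (N : OpenNormalSubgroup G) (x : CGA k G) :
    ∀ᶠ y in nhds x, proj k G N y = proj k G N x :=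
  (nhds_hasBasis x).mem_of_mem trivial

instance : IsTopologicalRing (CGA k G) where
  continuous_add := (continuous_iff _).2 fun N y => by
    filter_upwards [(continuous_fst.tendsto y).eventually (eventually_proj_eq N y.1),
      (continuous_snd.tendsto y).eventually (eventually_proj_eq N y.2)] with z h1 h2
    rw [map_add, map_add, h1, h2]
  continuous_mul := (continuous_iff _).2 fun N y => by
    filter_upwards [(continuous_fst.tendsto y).eventually (eventually_proj_eq N y.1),
      (continuous_snd.tendsto y).eventually (eventually_proj_eq N y.2)] with z h1 h2
    rw [map_mul, map_mul, h1, h2]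
  continuous_neg := (continuous_iff _).2 fun N y => by
    filter_upwards [eventually_proj_eq N y] with z h1
    rw [map_neg, map_neg, h1]

theorem continuous_of_proj {H : Type u} [Group H] [TopologicalSpace H] (f : CGA k H → CGA k G)
    (h : ∀ N, ∃ M, ∀ x y, proj k H M x = proj k H M y → proj k G N (f x) = proj k G N (f y)) :
    Continuous f :=
  (continuous_iff _).2 fun N y => by
    obtain ⟨M, hM⟩ := h N
    filter_upwards [eventually_proj_eq M y] with z hz using hM _ _ hz

theorem proj_of (N : OpenNormalSubgroup G) (g : G) :
    proj k G N (of k g) = MonoidAlgebra.of k (G ⧸ N.toSubgroup) (QuotientGroup.mk g) := rfl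

theorem proj_incl (H : Subgroup G) (N : OpenNormalSubgroup G) (x : CGA k H) :
    proj k G N (incl k H x) = interMap k H N (proj k H (interSubgroup H N) x) := rfl

theorem continuous_incl (H : Subgroup G) : Continuous (incl k H) :=
  continuous_of_proj _ fun N => ⟨interSubgroup H N, fun x y h => by
    rw [proj_incl, proj_incl, h]⟩

/-- An element of `k⟦G⟧` agrees modulo any open ideal with an element of the group algebra. -/
theorem exists_mem_span (N : OpenNormalSubgroup G) (x : CGA k G) :
    ∃ y ∈ Submodule.span k (Set.range (of k (G := G))), proj k G N y = proj k G N x := by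
  generalize proj k G N x = z
  induction z using MonoidAlgebra.induction_linear with
  | zero => exact ⟨0, zero_mem _, map_zero _⟩
  | add f g hf hg =>
    obtain ⟨y, hy, rfl⟩ := hf
    obtain ⟨y', hy', rfl⟩ := hg
    exact ⟨y + y', add_mem hy hy', map_add _ _ _⟩
  | single a b =>
    obtain ⟨g, rfl⟩ := QuotientGroup.mk_surjective a
    refine ⟨b • of k g, Submodule.smul_mem _ _ (Submodule.subset_span ⟨g, rfl⟩), ?_⟩
    rw [map_smul, proj_of]
    simp

theorem dense_span :
    Dense (Submodule.span k (Set.range (of k (G := G))) : Set (CGA k G)) := by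
  intro x
  rw [mem_closure_iff_nhds_basis (nhds_hasBasis x)]
  intro N _
  obtain ⟨y, hy, h⟩ := exists_mem_span N x
  exact ⟨y, hy, h⟩

/-- Closed linear conditions on `k⟦G⟧` may be checked on `G`. -/
theorem induction_on {p : CGA k G → Prop} (hp : IsClosed {x | p x})
    (of_mem : ∀ g, p (of k g)) (zero : p 0) (add : ∀ x y, p x → p y → p (x + y))
    (smul : ∀ (c : k) x, p x → p (c • x)) (x : CGA k G) : p x := by
  have h : (Submodule.span k (Set.range (of k (G := G))) : Set (CGA k G)) ⊆ {x | p x} := by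
    intro y hy
    induction hy using Submodule.span_induction with
    | mem y hy => obtain ⟨g, rfl⟩ := hy; exact of_mem g
    | zero => exact zero
    | add y z _ _ hy hz => exact add y z hy hz
    | smul c y _ hy => exact smul c y hy
  exact hp.closure_subset_iff.2 h (dense_span x)

theorem eventually_augmentation_eq (x : CGA k G) :
    ∀ᶠ y in nhds x, augmentation k G y = augmentation k G x := by
  filter_upwards [eventually_proj_eq (wholeGroup G) x] with y hy
  change MonoidAlgebra.lift k k _ 1 (proj k G (wholeGroup G) y) =
    MonoidAlgebra.lift k k _ 1 (proj k G (wholeGroup G) x)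
  rw [hy]

/-- The kernel of `k⟦G⟧ → k[G/N]`. -/
noncomputable def projKer (k : Type u) [Field k] (N : OpenNormalSubgroup G) : Ideal (CGA k G) :=
  RingHom.ker (proj k G N)

theorem mem_projKer {N : OpenNormalSubgroup G} {x : CGA k G} :
    x ∈ projKer k N ↔ proj k G N x = 0 := Iff.rfl

instance (N : OpenNormalSubgroup G) : (projKer k N).IsTwoSided :=
  inferInstanceAs (RingHom.ker (proj k G N)).IsTwoSided

theorem isOpen_projKer (N : OpenNormalSubgroup G) : IsOpen (projKer k N : Set (CGA k G)) := by
  rw [isOpen_iff_mem_nhds]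
  intro x hx
  filter_upwards [eventually_proj_eq N x] with y hy
  exact hy.trans hx

theorem exists_projKer_le {I : Ideal (CGA k G)} (hI : IsOpen (I : Set (CGA k G))) :
    ∃ N : OpenNormalSubgroup G, projKer k N ≤ I := by
  obtain ⟨N, -, hN⟩ := (nhds_hasBasis (0 : CGA k G)).mem_iff.1 (hI.mem_nhds I.zero_mem)
  exact ⟨N, fun x hx => hN ((mem_projKer.1 hx).trans (map_zero _).symm)⟩

theorem of_sub_one_mem_projKer {N : OpenNormalSubgroup G} {g : G} (hg : g ∈ N.toSubgroup) :
    of k g - 1 ∈ projKer k N := by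
  rw [mem_projKer, map_sub, map_one, proj_of, (QuotientGroup.eq_one_iff g).2 hg, map_one, sub_self]

/-- The augmentation ideal of `k⟦N⟧` is contained in the kernel of `k⟦G⟧ → k[G/N]`. -/
theorem incl_mem_projKer (N : OpenNormalSubgroup G) (i : CGA k N.toSubgroup)
    (hi : augmentation k N.toSubgroup i = 0) : incl k N.toSubgroup i ∈ projKer k N := by
  -- Subtracting the augmentation gives a condition on all of `k⟦N⟧` that is linear and closed, so
  -- that it can be checked on group elements, where it says `n - 1 ∈ projKer k N`.
  have key : ∀ i : CGA k N.toSubgroup, incl k N.toSubgroup i -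
      algebraMap k (CGA k G) (augmentation k N.toSubgroup i) ∈ projKer k N := by
    intro i
    refine induction_on (p := fun i => incl k N.toSubgroup i -
      algebraMap k (CGA k G) (augmentation k N.toSubgroup i) ∈ projKer k N) ?_ ?_ ?_ ?_ ?_ i
    · rw [← isOpen_compl_iff, isOpen_iff_mem_nhds]
      intro x hx
      filter_upwards [eventually_augmentation_eq x,
        ((continuous_incl N.toSubgroup).tendsto x).eventually (eventually_proj_eq N _)]
        with y h1 h2 h3
      refine hx ?_
      change _ ∈ projKer k N at h3
      change _ ∈ projKer k N
      rw [mem_projKer, map_sub] at h3 ⊢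
      rwa [h1, h2] at h3
    · intro g
      rw [incl_of, augmentation_of, map_one]
      exact of_sub_one_mem_projKer g.2
    · simp
    · intro x y hx hy
      have := add_mem hx hy
      simpa only [map_add, add_sub_add_comm] using this
    · intro c x hx
      have := Submodule.smul_of_tower_mem (projKer k N) c hx
      rwa [smul_sub, ← map_smul, Algebra.algebraMap_eq_smul_one, ← smul_assoc,
        ← Algebra.algebraMap_eq_smul_one, ← map_smul] at this
  simpa [hi] using key i

/-- An open ideal contains the kernel of some `k⟦G⟧ → k[G/N]`, and `G/N` is finite by compactness.
-/
theorem finite_quotient [IsTopologicalGroup G] [CompactSpace G] {I : Ideal (CGA k G)}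
    (hI : IsOpen (I : Set (CGA k G))) : Module.Finite k (CGA k G ⧸ I) := by
  obtain ⟨N, hN⟩ := exists_projKer_le hI
  have : Finite (G ⧸ N.toSubgroup) :=
    Subgroup.quotient_finite_of_isOpen N.toSubgroup N.isOpen'
  have h1 : Module.Finite k (CGA k G ⧸ (projKer k N)) := by
    let f : (CGA k G ⧸ (projKer k N)) →ₗ[k] MonoidAlgebra k (G ⧸ N.toSubgroup) :=
      { toFun := Quotient.lift (fun x => proj k G N x) (by
          intro a b h
          have := (Submodule.quotientRel_def _).1 h
          rw [mem_projKer, map_sub, sub_eq_zero] at this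
          exact this)
        map_add' := by rintro ⟨x⟩ ⟨y⟩; exact map_add _ _ _
        map_smul' := by rintro c ⟨x⟩; exact map_smul _ _ _ }
    refine Module.Finite.of_injective f (LinearMap.ker_eq_bot.1 ?_)
    rw [eq_bot_iff]
    rintro ⟨x⟩ hx
    exact (Submodule.Quotient.mk_eq_zero _).2 (mem_projKer.2 hx)
  exact Module.Finite.of_surjective ((Submodule.factor hN).restrictScalars k)
    (Submodule.factor_surjective hN)

section Linear

variable {U W : Type u} [AddCommGroup U] [Module (CGA k G) U] [TopologicalSpace U]
  [ContinuousSMul (CGA k G) U] [AddCommGroup W] [Module (CGA k G) W] [TopologicalSpace W]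
  [ContinuousSMul (CGA k G) W]

/-- A continuous additive map commuting with scalars and with `G` is `k⟦G⟧`-linear. -/
theorem map_smul_of_equivariant [Module k U] [Module k W] [IsScalarTower k (CGA k G) U]
    [IsScalarTower k (CGA k G) W] [T2Space W] (f : U →ₗ[k] W) (hf : Continuous f)
    (h : ∀ (g : G) u, f (of k g • u) = of k g • f u) (a : CGA k G) (u : U) : f (a • u) = a • f u := by
  refine induction_on (p := fun a => f (a • u) = a • f u) ?_ (fun g => h g u) (by simp) ?_ ?_ a
  · exact isClosed_eq (hf.comp (continuous_id.smul continuous_const))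
      (continuous_id.smul continuous_const)
  · intro x y hx hy
    rw [add_smul, add_smul, map_add, hx, hy]
  · intro c x hx
    rw [smul_assoc, map_smul, hx, smul_assoc]

end Linear

end CGA

/-! ### Pseudocompact modules: basic properties -/

section Pseudocompact

theorem finite_quotient_ker (k : Type*) {A M N : Type*} [Field k] [Ring A] [Algebra k A]
    [AddCommGroup M] [Module k M] [Module A M] [IsScalarTower k A M]
    [AddCommGroup N] [Module k N] [Module A N] [IsScalarTower k A N] [Module.Finite k N]
    (f : M →ₗ[A] N) : Module.Finite k (M ⧸ LinearMap.ker f) := by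
  have h : Function.Injective ((LinearMap.ker f).liftQ f le_rfl) :=
    LinearMap.ker_eq_bot.1 (Submodule.ker_liftQ_eq_bot _ _ _ le_rfl)
  exact Module.Finite.of_injective (((LinearMap.ker f).liftQ f le_rfl).restrictScalars k) h

variable {k A U : Type u} [Field k] [Ring A] [Algebra k A]
  [AddCommGroup U] [Module k U] [Module A U] [IsScalarTower k A U] [TopologicalSpace U]

namespace OpenFinSubmodule

instance : Preorder (OpenFinSubmodule k A U) := Preorder.lift Subtype.val

omit [TopologicalSpace U] in
theorem finite_inf {V W : Submodule A U} [FiniteDimensional k (U ⧸ V)]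
    [FiniteDimensional k (U ⧸ W)] : FiniteDimensional k (U ⧸ (V ⊓ W)) := by
  let f : (U ⧸ (V ⊓ W)) →ₗ[A] (U ⧸ V) × (U ⧸ W) :=
    (Submodule.factor inf_le_left).prod (Submodule.factor inf_le_right)
  refine Module.Finite.of_injective (f.restrictScalars k) (fun x y h => ?_)
  obtain ⟨x, rfl⟩ := Submodule.Quotient.mk_surjective _ x
  obtain ⟨y, rfl⟩ := Submodule.Quotient.mk_surjective _ y
  have h1 := (Submodule.Quotient.eq V).1 (congrArg Prod.fst h)
  have h2 := (Submodule.Quotient.eq W).1 (congrArg Prod.snd h)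
  exact (Submodule.Quotient.eq _).2 ⟨h1, h2⟩

omit [TopologicalSpace U] in
theorem finite_of_le {V W : Submodule A U} (h : V ≤ W) [FiniteDimensional k (U ⧸ V)] :
    FiniteDimensional k (U ⧸ W) :=
  Module.Finite.of_surjective ((Submodule.factor h).restrictScalars k)
    (Submodule.factor_surjective h)

/-- Codirectedness makes `Filter.atBot` on the open submodules a proper filter; the generalized
limit is taken along it. -/
instance : IsCodirectedOrder (OpenFinSubmodule k A U) where
  directed V W := ⟨⟨V.1 ⊓ W.1, V.2.1.inter W.2.1, by
    have := V.2.2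
    have := W.2.2
    exact finite_inf⟩, (inf_le_left : V.1 ⊓ W.1 ≤ V.1), (inf_le_right : V.1 ⊓ W.1 ≤ W.1)⟩

instance : Nonempty (OpenFinSubmodule k A U) :=
  ⟨⟨⊤, isOpen_univ, inferInstance⟩⟩

end OpenFinSubmodule

theorem IsPseudocompactModule.t2Space (k A : Type u) {U : Type u} [Field k] [Ring A] [Algebra k A]
    [AddCommGroup U] [Module k U] [Module A U] [IsScalarTower k A U] [TopologicalSpace U]
    [IsTopologicalAddGroup U] [IsPseudocompactModule k A U] : T2Space U := by
  have : T1Space U := by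
    refine IsTopologicalAddGroup.t1Space U ?_
    rw [← closure_subset_iff_isClosed]
    intro x hx
    refine IsPseudocompactModule.separated (k := k) (A := A) x fun V => ?_
    have hc : IsClosed (V.1 : Set U) := V.1.toAddSubgroup.isClosed_of_isOpen V.2.1
    exact hc.closure_subset_iff.2 (Set.singleton_subset_iff.2 V.1.zero_mem) hx
  infer_instance

theorem IsPseudocompactModule.exists_le [IsPseudocompactModule k A U] {s : Set U}
    (hs : s ∈ nhds (0 : U)) : ∃ V : OpenFinSubmodule k A U, (V.1 : Set U) ⊆ s := by
  obtain ⟨V, hV, h⟩ := (IsPseudocompactModule.hasBasis (k := k) (A := A)).mem_iff.1 hs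
  exact ⟨⟨V, hV⟩, h⟩

theorem isPseudocompactModule_of_discrete [DiscreteTopology U] [FiniteDimensional k U] :
    IsPseudocompactModule k A U where
  hasBasis := by
    rw [nhds_discrete]
    refine ⟨fun s => ⟨fun h => ⟨⊥, ⟨isOpen_discrete _, inferInstance⟩, ?_⟩, ?_⟩⟩
    · rintro x hx
      rw [(Submodule.mem_bot A).1 hx]
      exact h
    · rintro ⟨V, -, hV⟩
      exact hV V.zero_mem
  separated u h := h ⟨⊥, isOpen_discrete _, inferInstance⟩
  complete x hx := by
    let B : OpenFinSubmodule k A U := ⟨⊥, isOpen_discrete _, inferInstance⟩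
    obtain ⟨u, hu⟩ := Submodule.Quotient.mk_surjective _ (x B)
    refine ⟨u, fun V => ?_⟩
    rw [← hx B V bot_le, ← hu]
    rfl

theorem Submodule.discreteTopology_quotient [IsTopologicalAddGroup U] (V : Submodule A U)
    (hV : IsOpen (V : Set U)) : DiscreteTopology (U ⧸ V) :=
  QuotientAddGroup.discreteTopology (G := U) (N := V.toAddSubgroup) hV

/-- Among the images of open submodules in the Artinian module `U ⧸ C` there is a minimal one, that
of `V` say. If `x ∈ V` were outside the closed set `C`, some open `W` would have `x + W` disjoint
from `C`. By minimality `V ∩ W` has the same image as `V`, so `x` would be congruent modulo `C` to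
an element of `W`, a contradiction. Hence `V ≤ C`. -/
theorem Submodule.isOpen_of_isClosed_of_finite [IsTopologicalAddGroup U]
    [IsPseudocompactModule k A U]
    (C : Submodule A U) (hC : IsClosed (C : Set U)) [FiniteDimensional k (U ⧸ C)] :
    IsOpen (C : Set U) := by
  have : IsArtinian A (U ⧸ C) := isArtinian_of_tower k inferInstance
  obtain ⟨_, ⟨V, rfl⟩, hV⟩ := IsArtinian.set_has_minimal
    (Set.range fun V : OpenFinSubmodule k A U => V.1.map C.mkQ) (Set.range_nonempty _)
  refine AddSubgroup.isOpen_mono (H₁ := V.1.toAddSubgroup) (H₂ := C.toAddSubgroup)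
    (fun x hx => ?_) V.2.1
  by_contra hxC
  have h0 : {y : U | x + y ∉ C} ∈ nhds (0 : U) := by
    refine (hC.isOpen_compl.preimage (continuous_const.add continuous_id)).mem_nhds ?_
    simpa using hxC
  obtain ⟨W, hW⟩ := IsPseudocompactModule.exists_le (k := k) (A := A) h0
  obtain ⟨Z, hZV, hZW⟩ := exists_le_le V W
  have hle : Z.1.map C.mkQ ≤ V.1.map C.mkQ := Submodule.map_mono hZV
  have hx' : C.mkQ x ∈ Z.1.map C.mkQ := by
    rw [eq_of_le_of_not_lt hle (hV _ ⟨Z, rfl⟩)]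
    exact ⟨x, hx, rfl⟩
  obtain ⟨z, hz, hzx⟩ := hx'
  refine hW (Z.1.neg_mem hz |> fun h => hZW h) ?_
  have := (Submodule.Quotient.eq C).1 hzx
  rw [← C.neg_mem_iff] at this
  simpa [sub_eq_add_neg, add_comm] using this

/-- An inverse limit of finite-dimensional modules is pseudocompact. -/
theorem isPseudocompactModule_of_basis {ι : Type*} (K : ι → Submodule A U)
    (hopen : ∀ i, IsOpen (K i : Set U)) (hfin : ∀ i, FiniteDimensional k (U ⧸ K i))
    (hbasis : ∀ s ∈ nhds (0 : U), ∃ i, (K i : Set U) ⊆ s)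
    (hsep : ∀ u, (∀ i, u ∈ K i) → u = 0)
    (hcomplete : ∀ y : ι → U, (∀ i j, K i ≤ K j → y i - y j ∈ K j) → ∃ u : U, ∀ i, u - y i ∈ K i) :
    IsPseudocompactModule k A U where
  hasBasis := by
    refine ⟨fun s => ⟨fun h => ?_, ?_⟩⟩
    · obtain ⟨i, hi⟩ := hbasis s h
      exact ⟨_, ⟨hopen i, hfin i⟩, hi⟩
    · rintro ⟨V, hV, h⟩
      exact Filter.mem_of_superset (hV.1.mem_nhds V.zero_mem) h
  separated u h := hsep u fun i => h ⟨_, hopen i, hfin i⟩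
  complete x hx := by
    choose y hy using fun i => Submodule.Quotient.mk_surjective _ (x ⟨_, hopen i, hfin i⟩)
    obtain ⟨u, hu⟩ := hcomplete y fun i j h => by
      have := hx ⟨_, hopen i, hfin i⟩ ⟨_, hopen j, hfin j⟩ h
      rw [← hy, ← hy] at this
      exact (Submodule.Quotient.eq _).1 this
    refine ⟨u, fun V => ?_⟩
    obtain ⟨i, hi⟩ := hbasis V.1 (V.2.1.mem_nhds V.1.zero_mem)
    rw [← hx ⟨_, hopen i, hfin i⟩ V hi, ← hy i, ← (Submodule.Quotient.eq _).2 (hu i)]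
    rfl

theorem IsPseudocompactModule.exists_of_compatible [IsPseudocompactModule k A U]
    (y : OpenFinSubmodule k A U → U) (hy : ∀ V W, V.1 ≤ W.1 → y V - y W ∈ W.1) :
    ∃ u : U, ∀ V, u - y V ∈ V.1 := by
  obtain ⟨u, hu⟩ := IsPseudocompactModule.complete (k := k) (A := A) (U := U)
    (fun V => Submodule.Quotient.mk (y V))
    (fun V W h => (Submodule.Quotient.eq W.1).2 (hy V W h))
  exact ⟨u, fun V => (Submodule.Quotient.eq V.1).1 (hu V)⟩

end Pseudocompact

/-! ### Restriction -/

section Restriction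

variable {k G : Type u} [Field k] [Group G] [TopologicalSpace G] (H : Subgroup G) (U : Type u)
  [AddCommGroup U]

namespace Res

instance [Module k U] [Module (CGA k G) U] [IsScalarTower k (CGA k G) U] :
    IsScalarTower k (CGA k H) (Res k H U) where
  smul_assoc c b u := by
    have := smul_assoc c (CGA.incl k H b) ((mk k H U).symm u)
    rw [← map_smul (CGA.incl k H)] at this
    exact this

variable [TopologicalSpace U]

instance [IsTopologicalAddGroup U] : IsTopologicalAddGroup (Res k H U) :=
  inferInstanceAs (IsTopologicalAddGroup U)

instance [T2Space U] : T2Space (Res k H U) :=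
  inferInstanceAs (T2Space U)

instance [Module (CGA k G) U] [ContinuousSMul (CGA k G) U] :
    ContinuousSMul (CGA k H) (Res k H U) where
  continuous_smul := by
    have : Continuous fun p : CGA k H × U => CGA.incl k H p.1 • p.2 :=
      ((CGA.continuous_incl H).comp continuous_fst).smul continuous_snd
    exact this

variable {U} in
/-- An open submodule of `U`, as a submodule of the restriction of `U`. -/
def sub [Module (CGA k G) U] (V : Submodule (CGA k G) U) : Submodule (CGA k H) (Res k H U) where
  carrier := {u | (mk k H U).symm u ∈ V}
  add_mem' := fun hu hv => V.add_mem hu hv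
  zero_mem' := V.zero_mem
  smul_mem' := fun _ _ hu => V.smul_mem _ hu

variable [Module k U] [Module (CGA k G) U] [IsScalarTower k (CGA k G) U]

variable {U} in
/-- An open submodule of `U`, as an open submodule of the restriction of `U`. -/
def openFinSub (V : OpenFinSubmodule k (CGA k G) U) :
    OpenFinSubmodule k (CGA k H) (Res k H U) :=
  ⟨sub H V.1, V.2.1, by
    have := V.2.2
    let f : (Res k H U ⧸ sub H V.1) →ₗ[k] U ⧸ V.1 :=
      { toFun := Quotient.lift (fun u => Submodule.Quotient.mk ((mk k H U).symm u)) (by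
          intro a b h
          exact (Submodule.Quotient.eq V.1).2 ((Submodule.quotientRel_def (sub H V.1)).1 h))
        map_add' := by rintro ⟨x⟩ ⟨y⟩; rfl
        map_smul' := by rintro c ⟨x⟩; rfl }
    refine Module.Finite.of_injective f (LinearMap.ker_eq_bot.1 ?_)
    rw [eq_bot_iff]
    rintro ⟨x⟩ hx
    exact (Submodule.Quotient.mk_eq_zero _).2
      ((Submodule.Quotient.mk_eq_zero V.1).1 (LinearMap.mem_ker.1 hx))⟩

/-- There may be more open `k⟦H⟧`-submodules than open `k⟦G⟧`-submodules, but the latter already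
form a basis at `0`, which is enough. -/
instance [IsPseudocompactModule k (CGA k G) U] :
    IsPseudocompactModule k (CGA k H) (Res k H U) := by
  refine isPseudocompactModule_of_basis (ι := OpenFinSubmodule k (CGA k G) U)
    (fun V => (openFinSub H V).1) (fun V => (openFinSub H V).2.1) (fun V => (openFinSub H V).2.2)
    (fun s hs => ?_) (fun u hu => ?_) (fun y hy => ?_)
  · exact IsPseudocompactModule.exists_le (k := k) (A := CGA k G) (U := U) hs
  · exact IsPseudocompactModule.separated (k := k) (A := CGA k G) (U := U) u hu
  · exact IsPseudocompactModule.exists_of_compatible (k := k) (A := CGA k G) (U := U) y hy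

end Res

end Restriction

/-! ### The completed tensor product as a pseudocompact module -/

section CompletedTensor

variable {k A B : Type u} [Field k] [Ring A] [Algebra k A] [TopologicalSpace A]
  [Ring B] [Algebra k B]

namespace TensorIndex

variable {V : Type u} [AddCommGroup V] [Module B V] [TopologicalSpace V]

/-- The intersection of two indices. -/
def inf (p q : TensorIndex A B V) : TensorIndex A B V where
  ideal := p.ideal ⊓ q.ideal
  twoSided := by
    have := p.twoSided
    have := q.twoSided
    exact ⟨fun b ha => ⟨Ideal.mul_mem_right b _ ha.1, Ideal.mul_mem_right b _ ha.2⟩⟩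
  isOpen_ideal := p.isOpen_ideal.inter q.isOpen_ideal
  sub := p.sub ⊓ q.sub
  isOpen_sub := p.isOpen_sub.inter q.isOpen_sub

instance : Nonempty (TensorIndex A B V) :=
  ⟨⟨⊤, inferInstance, isOpen_univ, ⊤, isOpen_univ⟩⟩

end TensorIndex

variable (f : B →ₐ[k] A) (V : Type u) [AddCommGroup V] [Module k V] [Module B V]
  [TopologicalSpace V]

namespace FinTensor

noncomputable instance (p : TensorIndex A B V) : Module k (FinTensor f V p) :=
  inferInstanceAs (Module k ((A ⊗[k] V) ⧸ tensorRel f V p))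

instance (p : TensorIndex A B V) : IsScalarTower k A (FinTensor f V p) :=
  inferInstanceAs (IsScalarTower k A ((A ⊗[k] V) ⧸ tensorRel f V p))

variable {f V}

theorem mk_surjective (p : TensorIndex A B V) : Function.Surjective (FinTensor.mk f V p) :=
  Submodule.mkQ_surjective _

theorem mk_eq_zero {p : TensorIndex A B V} {x : A ⊗[k] V} :
    FinTensor.mk f V p x = 0 ↔ x ∈ tensorRel f V p :=
  Submodule.Quotient.mk_eq_zero _

theorem mk_tmul_of_mem_sub {p : TensorIndex A B V} (a : A) {v : V} (hv : v ∈ p.sub) :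
    FinTensor.mk f V p (a ⊗ₜ[k] v) = 0 :=
  mk_eq_zero.2 (Submodule.subset_span (Or.inr ⟨a, v, hv, rfl⟩))

theorem mk_mul_tmul (p : TensorIndex A B V) (a : A) (b : B) (v : V) :
    FinTensor.mk f V p ((a * f b) ⊗ₜ[k] v) = FinTensor.mk f V p (a ⊗ₜ[k] (b • v)) := by
  rw [← sub_eq_zero, ← map_sub]
  exact mk_eq_zero.2 (Submodule.subset_span (Or.inl (Or.inl ⟨a, b, v, rfl⟩)))

theorem ideal_smul {p : TensorIndex A B V} {a : A} (ha : a ∈ p.ideal) (x : FinTensor f V p) :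
    a • x = 0 := by
  obtain ⟨x, rfl⟩ := mk_surjective p x
  rw [← map_smul]
  induction x with
  | zero => simp
  | add x y hx hy => rw [smul_add, map_add, hx, hy, add_zero]
  | tmul b v =>
    rw [TensorProduct.smul_tmul']
    -- Here `a` multiplies `b` from the left while `a` is the factor in the ideal, so absorption on
    -- the right is needed.
    have := p.twoSided
    exact mk_eq_zero.2 (Submodule.subset_span
      (Or.inl (Or.inr ⟨a • b, Ideal.mul_mem_right b p.ideal ha, v, rfl⟩)))

/-- The factor is a quotient of the finite-dimensional space `(A ⧸ I) ⊗[k] (V ⧸ W)`: the kernel of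
the map from `A ⊗[k] V` onto that space is spanned by the images of `I ⊗ V` and `A ⊗ W`, both
contained in `tensorRel`. -/
theorem finite [IsScalarTower k B V] (p : TensorIndex A B V) [Module.Finite k (A ⧸ p.ideal)]
    [Module.Finite k (V ⧸ p.sub)] : Module.Finite k (FinTensor f V p) := by
  let g : A →ₗ[k] A ⧸ p.ideal := p.ideal.mkQ.restrictScalars k
  let g' : V →ₗ[k] V ⧸ p.sub := p.sub.mkQ.restrictScalars k
  have hg : Function.Exact (p.ideal.restrictScalars k).subtype g := by
    intro x
    exact (Submodule.Quotient.mk_eq_zero p.ideal).trans (by simp)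
  have hg' : Function.Exact (p.sub.restrictScalars k).subtype g' := by
    intro x
    exact (Submodule.Quotient.mk_eq_zero p.sub).trans (by simp)
  have hker := TensorProduct.map_ker hg (Submodule.mkQ_surjective p.ideal) hg'
    (Submodule.mkQ_surjective p.sub)
  have hle : LinearMap.ker (TensorProduct.map g g') ≤
      LinearMap.ker ((FinTensor.mk f V p).restrictScalars k) := by
    rw [hker, sup_le_iff]
    constructor
    · rintro _ ⟨x, rfl⟩
      induction x with
      | zero => simp
      | add x y hx hy => rw [map_add]; exact add_mem hx hy
      | tmul a v => exact mk_tmul_of_mem_sub a v.2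
    · rintro _ ⟨x, rfl⟩
      induction x with
      | zero => simp
      | add x y hx hy => rw [map_add]; exact add_mem hx hy
      | tmul a v =>
        exact mk_eq_zero.2 (Submodule.subset_span (Or.inl (Or.inr ⟨a.1, a.2, v, rfl⟩)))
  have h1 : Module.Finite k ((A ⊗[k] V) ⧸ LinearMap.ker (TensorProduct.map g g')) :=
    Module.Finite.of_injective
      ((LinearMap.ker (TensorProduct.map g g')).liftQ (TensorProduct.map g g') le_rfl)
      (LinearMap.ker_eq_bot.1 (Submodule.ker_liftQ_eq_bot _ _ _ le_rfl))
  refine Module.Finite.of_surjective (Submodule.liftQ _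
    ((FinTensor.mk f V p).restrictScalars k) hle) fun x => ?_
  obtain ⟨x, rfl⟩ := mk_surjective p x
  exact ⟨Submodule.Quotient.mk x, rfl⟩

end FinTensor

namespace CompletedTensor

noncomputable instance : Module k (CompletedTensor f V) :=
  Module.compHom (CompletedTensor f V) (algebraMap k A)

instance : IsScalarTower k A (CompletedTensor f V) where
  smul_assoc c a x := by
    rw [Algebra.smul_def, mul_smul]
    rfl

variable {f V}

theorem ext_proj {x y : CompletedTensor f V} (h : ∀ p, proj f V p x = proj f V p y) : x = y :=
  Subtype.ext (funext h)

theorem transition_proj {p q : TensorIndex A B V} (hI : p.ideal ≤ q.ideal)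
    (hW : p.sub ≤ q.sub) (x : CompletedTensor f V) :
    FinTensor.transition f V hI hW (proj f V p x) = proj f V q x :=
  x.2 p q hI hW

theorem proj_eq_of_le {p q : TensorIndex A B V} (hI : p.ideal ≤ q.ideal)
    (hW : p.sub ≤ q.sub) {x y : CompletedTensor f V} (h : proj f V p x = proj f V p y) :
    proj f V q x = proj f V q y := by
  rw [← transition_proj hI hW, ← transition_proj hI hW, h]

theorem continuous_iff {Y : Type*} [TopologicalSpace Y] (g : Y → CompletedTensor f V) :
    Continuous g ↔ ∀ p y, ∀ᶠ z in nhds y, proj f V p (g z) = proj f V p (g y) :=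
  continuous_limit_iff (fun p => proj f V p) g

theorem nhds_hasBasis (x : CompletedTensor f V) :
    (nhds x).HasBasis (fun _ : TensorIndex A B V => True)
      (fun p => {y | proj f V p y = proj f V p x}) :=
  nhds_limit_hasBasis (fun p => proj f V p)
    (fun p q => ⟨p.inf q, fun _ _ h => ⟨proj_eq_of_le inf_le_left inf_le_left h,
      proj_eq_of_le inf_le_right inf_le_right h⟩⟩) x

theorem eventually_proj_eq (p : TensorIndex A B V) (x : CompletedTensor f V) :
    ∀ᶠ y in nhds x, proj f V p y = proj f V p x :=
  (nhds_hasBasis x).mem_of_mem trivial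

theorem proj_tmul (p : TensorIndex A B V) (a : A) (v : V) :
    proj f V p (tmul f V a v) = FinTensor.mk f V p (a ⊗ₜ[k] v) := rfl

theorem smul_tmul (a b : A) (v : V) : a • tmul f V b v = tmul f V (a * b) v := rfl

theorem tmul_smul (a : A) (b : B) (v : V) : tmul f V a (b • v) = tmul f V (a * f b) v :=
  ext_proj fun p => (FinTensor.mk_mul_tmul p a b v).symm

theorem tmul_add (a : A) (v w : V) : tmul f V a (v + w) = tmul f V a v + tmul f V a w :=
  ext_proj fun p => by
    rw [map_add, proj_tmul, proj_tmul, proj_tmul, TensorProduct.tmul_add, map_add]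

theorem continuous_tmul [IsTopologicalAddGroup V] (a : A) : Continuous (tmul f V a) := by
  refine (continuous_iff _).2 fun p v => ?_
  have h : {w | w - v ∈ p.sub} ∈ nhds v := by
    refine (p.isOpen_sub.preimage (continuous_id.sub continuous_const)).mem_nhds ?_
    simp
  filter_upwards [h] with w hw
  rw [proj_tmul, proj_tmul, ← sub_eq_zero, ← map_sub, ← TensorProduct.tmul_sub]
  exact FinTensor.mk_tmul_of_mem_sub a hw

instance [IsTopologicalAddGroup A] : ContinuousSMul A (CompletedTensor f V) where
  continuous_smul := by
    refine (continuous_iff _).2 fun p y => ?_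
    have h : {a | a - y.1 ∈ p.ideal} ∈ nhds y.1 := by
      refine (p.isOpen_ideal.preimage (continuous_id.sub continuous_const)).mem_nhds ?_
      simp
    filter_upwards [continuous_fst.tendsto y h,
      (continuous_snd.tendsto y).eventually (eventually_proj_eq p y.2)] with z h1 h2
    rw [map_smul, map_smul, h2, ← sub_eq_zero, ← sub_smul]
    exact FinTensor.ideal_smul h1 _

instance : T2Space (CompletedTensor f V) := by
  have : T1Space (CompletedTensor f V) := by
    refine IsTopologicalAddGroup.t1Space _ ?_
    rw [← closure_subset_iff_isClosed]
    intro x hx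
    refine ext_proj fun p => ?_
    obtain ⟨y, hy, h⟩ := (mem_closure_iff_nhds_basis (nhds_hasBasis x)).1 hx p trivial
    rw [← show _ = _ from h, Set.mem_singleton_iff.1 hy]
  infer_instance

theorem exists_mk_eq_proj (p : TensorIndex A B V) (x : CompletedTensor f V) :
    ∃ t : A ⊗[k] V, FinTensor.mk f V p t = proj f V p x :=
  FinTensor.mk_surjective p _

variable (f V) in
/-- The canonical map from the tensor product to the completed tensor product. -/
noncomputable def ofTensor : A ⊗[k] V →+ CompletedTensor f V where
  toFun t := ⟨fun p => FinTensor.mk f V p t, fun _ _ _ _ => rfl⟩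
  map_zero' := ext_proj fun p => map_zero (FinTensor.mk f V p)
  map_add' s t := ext_proj fun p => map_add (FinTensor.mk f V p) s t

theorem proj_ofTensor (p : TensorIndex A B V) (t : A ⊗[k] V) :
    proj f V p (ofTensor f V t) = FinTensor.mk f V p t := rfl

/-- Continuous additive maps are determined by their values on pure tensors. -/
theorem addHom_ext {W : Type*} [AddCommGroup W] [TopologicalSpace W] [T2Space W]
    (g h : CompletedTensor f V →+ W) (hg : Continuous g) (hh : Continuous h)
    (e : ∀ a v, g (tmul f V a v) = h (tmul f V a v)) (x : CompletedTensor f V) : g x = h x := by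
  have hdense : x ∈ closure (Set.range (ofTensor f V)) := by
    rw [mem_closure_iff_nhds_basis (nhds_hasBasis x)]
    intro p _
    obtain ⟨t, ht⟩ := exists_mk_eq_proj p x
    exact ⟨_, ⟨t, rfl⟩, ht⟩
  have hsub : Set.range (ofTensor f V) ⊆ {x | g x = h x} := by
    rintro _ ⟨t, rfl⟩
    induction t with
    | zero => simp
    | add s t hs ht =>
      change g _ = h _
      rw [map_add, map_add, map_add, show g _ = h _ from hs, show g _ = h _ from ht]
    | tmul a v => exact e a v
  exact (isClosed_eq hg hh).closure_subset_iff.2 hsub hdense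

/-- The kernels of the projections to the finite-dimensional factors form a basis at `0`.
Completeness is built in, since a compatible family of components is by definition an element. -/
theorem isPseudocompactModule [IsScalarTower k B V] [IsPseudocompactModule k B V]
    (hA : ∀ I : Ideal A, IsOpen (I : Set A) → Module.Finite k (A ⧸ I)) :
    IsPseudocompactModule k A (CompletedTensor f V) := by
  have hker : ∀ p (x y : CompletedTensor f V),
      x - y ∈ LinearMap.ker (proj f V p) ↔ proj f V p x = proj f V p y := fun p x y => by
    rw [LinearMap.mem_ker, map_sub, sub_eq_zero]
  refine isPseudocompactModule_of_basis (fun p => LinearMap.ker (proj f V p)) ?_ ?_ ?_ ?_ ?_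
  · exact fun p => isOpen_preimage f V p {0}
  · intro p
    have := hA p.ideal p.isOpen_ideal
    have : Module.Finite k (V ⧸ p.sub) := by
      obtain ⟨W, hW⟩ := IsPseudocompactModule.exists_le (k := k) (A := B)
        (p.isOpen_sub.mem_nhds p.sub.zero_mem)
      have := W.2.2
      exact OpenFinSubmodule.finite_of_le hW
    have := FinTensor.finite (f := f) p
    exact finite_quotient_ker k (proj f V p)
  · intro s hs
    obtain ⟨p, -, hp⟩ := (nhds_hasBasis (0 : CompletedTensor f V)).mem_iff.1 hs
    exact ⟨p, fun x hx => hp ((LinearMap.mem_ker.1 hx).trans (map_zero _).symm)⟩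
  · exact fun u hu => ext_proj fun p => (hu p).trans (map_zero _).symm
  · intro y hy
    have hle : ∀ p q : TensorIndex A B V, p.ideal ≤ q.ideal → p.sub ≤ q.sub →
        LinearMap.ker (proj f V p) ≤ LinearMap.ker (proj f V q) := fun p q hI hW x hx => by
      rw [LinearMap.mem_ker, ← transition_proj hI hW, LinearMap.mem_ker.1 hx, map_zero]
    refine ⟨⟨fun p => proj f V p (y p), fun p q hI hW => ?_⟩, fun p => (hker _ _ _).2 rfl⟩
    rw [transition_proj]
    exact (hker _ _ _).1 (hy p q (hle p q hI hW))

/-- An additive map on `A ⊗[k] V` which is continuous for the inverse limit topology extends to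
the completed tensor product. -/
theorem exists_extension {R W : Type u} [Ring R] [Algebra k R] [AddCommGroup W] [Module k W]
    [Module R W] [IsScalarTower k R W] [TopologicalSpace W] [IsTopologicalAddGroup W]
    [IsPseudocompactModule k R W] (Φ : A ⊗[k] V →+ W)
    (hΦ : ∀ W' : OpenFinSubmodule k R W, ∃ p : TensorIndex A B V,
      ∀ x ∈ tensorRel f V p, Φ x ∈ W'.1) :
    ∃ θ : CompletedTensor f V →+ W, Continuous θ ∧ ∀ t, θ (ofTensor f V t) = Φ t := by
  -- `p W'` is an index through which `Φ` modulo `W'` factors.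
  choose p hp using hΦ
  have hΦ' : ∀ W' q x y, (p W').ideal ≥ TensorIndex.ideal q → (p W').sub ≥ q.sub →
      FinTensor.mk f V q x = FinTensor.mk f V q y → Φ x - Φ y ∈ W'.1 := by
    intro W' q x y hI hW h
    rw [← map_sub]
    refine hp W' _ (tensorRel_mono f V hI hW (FinTensor.mk_eq_zero.1 ?_))
    rw [map_sub, h, sub_self]
  -- The value at `x` is pinned down by a condition on every index finer than `p W'` and every
  -- representative `t`. This freedom makes additivity and continuity a matter of choosing suitable
  -- representatives.
  have key : ∀ x : CompletedTensor f V, ∃ w : W, ∀ W' q t, (p W').ideal ≥ TensorIndex.ideal q →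
      (p W').sub ≥ q.sub → FinTensor.mk f V q t = proj f V q x → w - Φ t ∈ W'.1 := by
    intro x
    choose t ht using fun W' => exists_mk_eq_proj (p W') x
    have hmove : ∀ W' q s, (p W').ideal ≥ TensorIndex.ideal q →
        (p W').sub ≥ q.sub → FinTensor.mk f V q s = proj f V q x →
        Φ (t W') - Φ s ∈ W'.1 := by
      intro W' q s hI hW hs
      refine hΦ' W' (p W') _ _ le_rfl le_rfl ?_
      rw [ht, ← transition_proj hI hW, ← hs]
      rfl
    obtain ⟨w, hw⟩ := IsPseudocompactModule.exists_of_compatible (k := k) (A := R)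
      (fun W' => Φ (t W')) (by
        intro W₁ W₂ h
        -- The indices of `W₁` and `W₂` need not be comparable, so both values are compared with a
        -- representative at a common refinement.
        obtain ⟨s, hs⟩ := exists_mk_eq_proj ((p W₁).inf (p W₂)) x
        have h1 := hmove W₁ _ s inf_le_left inf_le_left hs
        have h2 := hmove W₂ _ s inf_le_right inf_le_right hs
        simpa using W₂.1.sub_mem (h h1) h2)
    refine ⟨w, fun W' q s hI hW hs => ?_⟩
    simpa using W'.1.add_mem (hw W') (hmove W' q s hI hW hs)
  choose θ hθ using key
  have : T2Space W := IsPseudocompactModule.t2Space k R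
  have eq_of : ∀ w w' : W, (∀ W' : OpenFinSubmodule k R W, w - w' ∈ W'.1) → w = w' :=
    fun w w' h => sub_eq_zero.1 (IsPseudocompactModule.separated (k := k) (A := R) _ h)
  have hadd : ∀ x y, θ (x + y) = θ x + θ y := by
    intro x y
    refine eq_of _ _ fun W' => ?_
    obtain ⟨s, hs⟩ := exists_mk_eq_proj (p W') x
    obtain ⟨t, ht⟩ := exists_mk_eq_proj (p W') y
    have h1 := hθ x W' _ s le_rfl le_rfl hs
    have h2 := hθ y W' _ t le_rfl le_rfl ht
    have h3 := hθ (x + y) W' _ (s + t) le_rfl le_rfl (by rw [map_add, map_add, hs, ht])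
    rw [map_add] at h3
    have := W'.1.sub_mem h3 (W'.1.add_mem h1 h2)
    convert this using 1
    abel
  refine ⟨AddMonoidHom.mk' θ hadd, ?_, fun t => ?_⟩
  · refine continuous_of_continuousAt_zero (AddMonoidHom.mk' θ hadd) ?_
    rw [ContinuousAt, map_zero,
      (IsPseudocompactModule.hasBasis (k := k) (A := R) (U := W)).tendsto_right_iff]
    intro W' hW'
    filter_upwards [eventually_proj_eq (p ⟨W', hW'⟩) (0 : CompletedTensor f V)] with x hx
    have := hθ x ⟨W', hW'⟩ _ 0 le_rfl le_rfl (by rw [hx, map_zero, map_zero])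
    simpa using this
  · exact eq_of _ _ fun W' => hθ _ W' _ t le_rfl le_rfl (proj_ofTensor _ t).symm

end CompletedTensor

end CompletedTensor

/-! ### Induced modules -/

section Induction

variable {k G : Type u} [Field k] [Group G] [TopologicalSpace G] {H : Subgroup G}

section Extension

variable {X : Type u} [AddCommGroup X] [Module k X] [Module (CGA k H) X] [TopologicalSpace X]
  {V : Type u} [AddCommGroup V] [Module k V] [Module (CGA k G) V] [IsScalarTower k (CGA k G) V]
  [TopologicalSpace V] [IsTopologicalAddGroup V] [ContinuousSMul (CGA k G) V]
  [IsPseudocompactModule k (CGA k G) V]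

/-- A right `k⟦H⟧`-linear endomorphism `e` of `k⟦G⟧` and a `k⟦H⟧`-linear map `f : X → V` define a
map `X↑^G → V`, `a ⊗ x ↦ e(a) f(x)`. -/
theorem Ind.exists_smul_extension (e : CGA k G →ₗ[k] CGA k G) (he : Continuous e)
    (hmul : ∀ a b, e (a * CGA.incl k H b) = e a * CGA.incl k H b)
    (f : X →ₗ[k] V) (hf : Continuous f) (hsmul : ∀ b x, f (b • x) = CGA.incl k H b • f x) :
    ∃ θ : Ind k H X →+ V, Continuous θ ∧
      ∀ a x, θ (CompletedTensor.tmul (CGA.incl k H) X a x) = e a • f x := by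
  let Φ : CGA k G ⊗[k] X →ₗ[k] V := TensorProduct.lift (LinearMap.mk₂ k (fun a x => e a • f x)
    (fun a b x => by rw [map_add, add_smul]) (fun c a x => by rw [map_smul, smul_assoc])
    (fun a x y => by rw [map_add, smul_add]) (fun c a x => by rw [map_smul, smul_comm]))
  have hΦ : ∀ a x, Φ (a ⊗ₜ[k] x) = e a • f x := fun a x => TensorProduct.lift.tmul _ _
  obtain ⟨θ, hθ, h⟩ := CompletedTensor.exists_extension (f := CGA.incl k H) (V := X)
    (R := CGA k G) Φ.toAddMonoidHom (by
      intro V'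
      -- Continuity of `e` gives an `M` such that `e` carries `projKer k M` into the annihilator of
      -- `V ⧸ V'`. The index sought consists of `projKer k M` and the preimage of `V'` under `f`.
      have hopen := (isOpen_annihilator k V').preimage he
      obtain ⟨M, -, hM⟩ := (CGA.nhds_hasBasis (0 : CGA k G)).mem_iff.1
        (hopen.mem_nhds (by simp))
      have hM' : ∀ a ∈ CGA.projKer k M, ∀ v, e a • v ∈ V'.1 := fun a ha v =>
        (Submodule.Quotient.mk_eq_zero V'.1).1
          (Module.mem_annihilator.1 (hM (ha.trans (map_zero _).symm)) (Submodule.Quotient.mk v))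
      refine ⟨⟨CGA.projKer k M, inferInstance, CGA.isOpen_projKer M,
        { carrier := {x | f x ∈ V'.1}
          add_mem' := fun hx hy => by
            change f _ ∈ V'.1
            rw [map_add]
            exact V'.1.add_mem hx hy
          zero_mem' := by
            change f _ ∈ V'.1
            rw [map_zero]
            exact V'.1.zero_mem
          smul_mem' := fun b x hx => by
            change f _ ∈ V'.1
            rw [hsmul]
            exact V'.1.smul_mem _ hx }, V'.2.1.preimage hf⟩, fun t ht => ?_⟩
      -- `tensorRel` is a span over `k⟦G⟧`, but `Φ` is only `k`-linear because `e` need not be left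
      -- linear. The induction therefore treats all multiples `a • t` at once.
      suffices h : ∀ a : CGA k G, Φ (a • t) ∈ V'.1 by simpa using h 1
      induction ht using Submodule.span_induction with
      | mem t ht =>
        intro a
        rcases ht with (⟨a', b, v, rfl⟩ | ⟨a', ha', v, rfl⟩) | ⟨a', v, hv, rfl⟩
        · rw [smul_sub, TensorProduct.smul_tmul', TensorProduct.smul_tmul', map_sub, hΦ, hΦ,
            smul_eq_mul, smul_eq_mul, ← mul_assoc, hmul, hsmul, mul_smul, sub_self]
          exact V'.1.zero_mem
        · rw [TensorProduct.smul_tmul', hΦ]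
          exact hM' _ (Ideal.mul_mem_left _ _ ha') _
        · rw [TensorProduct.smul_tmul', hΦ]
          exact V'.1.smul_mem _ hv
      | zero => simp
      | add s t _ _ hs ht =>
        intro a
        rw [smul_add, map_add]
        exact V'.1.add_mem (hs a) (ht a)
      | smul c t _ ht =>
        intro a
        rw [smul_smul]
        exact ht _)
  exact ⟨θ, hθ, fun a x => (h _).trans (hΦ a x)⟩

theorem Ind.clm_ext {W : Type u} [AddCommGroup W] [Module (CGA k G) W] [TopologicalSpace W]
    [T2Space W] (g h : Ind k H X →L[CGA k G] W)
    (e : ∀ x, g (CompletedTensor.tmul (CGA.incl k H) X 1 x) =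
      h (CompletedTensor.tmul (CGA.incl k H) X 1 x)) : g = h := by
  ext x
  refine CompletedTensor.addHom_ext (g : Ind k H X →+ W) (h : Ind k H X →+ W) g.continuous
    h.continuous (fun a v => ?_) x
  have := CompletedTensor.smul_tmul (f := CGA.incl k H) a 1 v
  rw [mul_one] at this
  change g _ = h _
  rw [← this, map_smul, map_smul, e]

/-- The universal property of the induced module. -/
theorem Ind.exists_lift [IsScalarTower k (CGA k H) X] (f : X →L[CGA k H] Res k H V) :
    ∃ θ : Ind k H X →L[CGA k G] V, ∀ x,
      θ (CompletedTensor.tmul (CGA.incl k H) X 1 x) = (Res.mk k H V).symm (f x) := by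
  have : T2Space V := IsPseudocompactModule.t2Space k (CGA k G)
  let f' : X →ₗ[k] V :=
    { toFun := fun x => (Res.mk k H V).symm (f x)
      map_add' := fun x y => by rw [map_add, map_add]
      map_smul' := fun c x => (f : X →ₗ[CGA k H] Res k H V).map_smul_of_tower c x }
  have hf' : Continuous f' := f.continuous
  -- Taking `e = id` makes the extension left linear; the traces below use the projection onto
  -- `k⟦K⟧` instead.
  obtain ⟨θ, hθ, h⟩ := Ind.exists_smul_extension LinearMap.id continuous_id (fun _ _ => rfl)
    f' hf' (fun b x => map_smul f b x)
  refine ⟨⟨⟨⟨θ, map_add θ⟩, fun a x => ?_⟩, hθ⟩, fun x => (h 1 x).trans (one_smul _ _)⟩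
  refine CompletedTensor.addHom_ext (θ.comp (DistribSMul.toAddMonoidHom _ a))
    ((DistribSMul.toAddMonoidHom V a).comp θ) (hθ.comp (continuous_const_smul a))
    ((continuous_const_smul a).comp hθ) (fun b v => ?_) x
  change θ (a • CompletedTensor.tmul _ _ b v) = a • θ (CompletedTensor.tmul _ _ b v)
  rw [CompletedTensor.smul_tmul, h, h, smul_smul]
  rfl

end Extension

/-- The unit `x ↦ 1 ⊗ x` of induction and restriction. -/
noncomputable def Ind.unit (H : Subgroup G) (X : Type u) [AddCommGroup X] [Module k X]
    [Module (CGA k H) X] [TopologicalSpace X] [IsTopologicalAddGroup X] :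
    X →L[CGA k H] Res k H (Ind k H X) where
  toFun x := Res.mk k H _ (CompletedTensor.tmul (CGA.incl k H) X 1 x)
  map_add' x y := CompletedTensor.tmul_add _ _ _
  map_smul' b x := by
    rw [CompletedTensor.tmul_smul, one_mul, RingHom.id_apply, Res.smul_mk,
      CompletedTensor.smul_tmul, mul_one]
  cont := CompletedTensor.continuous_tmul _

instance [IsTopologicalGroup G] [CompactSpace G] (H : Subgroup G) (X : Type u) [AddCommGroup X]
    [Module k X] [Module (CGA k H) X] [IsScalarTower k (CGA k H) X] [TopologicalSpace X]
    [IsPseudocompactModule k (CGA k H) X] :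
    IsPseudocompactModule k (CGA k G) (Ind k H X) :=
  CompletedTensor.isPseudocompactModule fun _ => CGA.finite_quotient

end Induction

/-! ### Relative projectivity and splittings -/

section RelProjective

variable {k G : Type u} [Field k] [Group G] [TopologicalSpace G] {H : Subgroup G}
  {U : Type u} [AddCommGroup U] [Module k U] [Module (CGA k G) U]
  [IsScalarTower k (CGA k G) U] [TopologicalSpace U] [IsTopologicalAddGroup U]
  [ContinuousSMul (CGA k G) U] [IsPseudocompactModule k (CGA k G) U]

theorem RelProjective.splits (h : RelProjective k H U) (V : Type u) [AddCommGroup V] [Module k V]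
    [Module (CGA k G) V] [IsScalarTower k (CGA k G) V] [TopologicalSpace V]
    [IsTopologicalAddGroup V] [ContinuousSMul (CGA k G) V] [IsPseudocompactModule k (CGA k G) V]
    (π : V →L[CGA k G] U) (hπ : Function.Surjective π) (hs : SplitsOver k H π) : Splits π :=
  h V U π (ContinuousLinearMap.id _ _) hπ hs

theorem naturalProj_surjective : Function.Surjective (naturalProj k H U) := fun u =>
  ⟨_, (naturalProj_tmul k H 1 u).trans (one_smul _ u)⟩

theorem splitsOver_naturalProj : SplitsOver k H (naturalProj k H U) :=
  ⟨Ind.unit H (Res k H U), fun u => (naturalProj_tmul k H 1 u).trans (one_smul _ u)⟩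

theorem Splits.isSummand {A : Type u} [Ring A] {V U : Type u}
    [AddCommGroup V] [Module A V] [TopologicalSpace V]
    [AddCommGroup U] [Module A U] [TopologicalSpace U] {π : V →L[A] U} (h : Splits π) :
    IsSummand A U V := by
  obtain ⟨s, hs⟩ := h
  refine ⟨LinearMap.range (s : U →ₗ[A] V), ⟨(s.comp π).codRestrict _ fun x => ⟨π x, rfl⟩, ?_⟩,
    ⟨?_⟩⟩
  · rintro ⟨_, u, rfl⟩
    exact Subtype.ext (congrArg s (hs u))
  · exact
      { toFun := fun u => ⟨s u, u, rfl⟩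
        invFun := fun v => π v
        left_inv := hs
        right_inv := by
          rintro ⟨_, u, rfl⟩
          exact Subtype.ext (congrArg s (hs u))
        map_add' := fun u v => Subtype.ext (map_add s u v)
        map_smul' := fun a u => Subtype.ext (map_smul s a u)
        continuous_toFun := s.continuous.subtype_mk _
        continuous_invFun := π.continuous.comp continuous_subtype_val }

/-- Continuous direct summands of modules induced from `H` are relatively `H`-projective. -/
theorem IsSummand.relProjective {X : Type u} [AddCommGroup X] [Module k X] [Module (CGA k H) X]
    [IsScalarTower k (CGA k H) X] [TopologicalSpace X] [IsTopologicalAddGroup X]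
    {U : Type u} [AddCommGroup U] [Module (CGA k G) U] [TopologicalSpace U]
    (h : IsSummand (CGA k G) U (Ind k H X)) : RelProjective k H U := by
  obtain ⟨P, ⟨r, hr⟩, ⟨i⟩⟩ := h
  intro V W _ _ _ _ _ _ _ _ _ _ _ _ _ _ _ _ β φ _ ⟨ψ, hψ⟩
  have : T2Space W := IsPseudocompactModule.t2Space k (CGA k G)
  let r' : Ind k H X →L[CGA k G] U := i.symm.toContinuousLinearMap.comp r
  let r₀ : Res k H (Ind k H X) →L[CGA k H] Res k H U :=
    ⟨⟨⟨fun x => Res.mk k H U (r' ((Res.mk k H _).symm x)), fun x y => map_add r' _ _⟩,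
      fun b x => map_smul r' _ _⟩, r'.continuous⟩
  -- The `k⟦H⟧`-map `x ↦ ψ(r'(1 ⊗ x))` extends to `θ` by adjunction. Then `β θ` and `φ r'` agree on
  -- all `1 ⊗ x`, hence everywhere.
  obtain ⟨θ, hθ⟩ := Ind.exists_lift (V := V) (ψ.comp (r₀.comp (Ind.unit H X)))
  have key : β.comp θ = φ.comp r' := by
    refine Ind.clm_ext _ _ fun x => ?_
    change β (θ _) = φ (r' _)
    rw [hθ]
    exact hψ _
  refine ⟨θ.comp (P.subtypeL.comp i.toContinuousLinearMap), fun u => ?_⟩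
  have h1 := DFunLike.congr_fun key (i u : Ind k H X)
  change β (θ (i u)) = φ (i.symm (r (i u))) at h1
  rw [hr, ContinuousLinearEquiv.symm_apply_apply] at h1
  exact h1

end RelProjective

/-! ### Multiplication of `k⟦G⟧` by a locally constant function -/

namespace CGA

variable {k G : Type u} [Field k] [Group G] [TopologicalSpace G]

/-- Multiplication by a function on `G/M`, as a map `k[G/(N ∩ M)] → k[G/N]`. -/
noncomputable def mulFunLevel (M : OpenNormalSubgroup G) (φ : G ⧸ M.toSubgroup → k)
    (N : OpenNormalSubgroup G) :
    MonoidAlgebra k (G ⧸ (N ⊓ M).toSubgroup) →ₗ[k] MonoidAlgebra k (G ⧸ N.toSubgroup) :=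
  (Finsupp.linearCombination k fun x : G ⧸ (N ⊓ M).toSubgroup =>
    φ (QuotientGroup.map _ M.toSubgroup (MonoidHom.id G) inf_le_right x) •
      MonoidAlgebra.of k (G ⧸ N.toSubgroup)
        (QuotientGroup.map _ N.toSubgroup (MonoidHom.id G) inf_le_left x)) ∘ₗ
    (MonoidAlgebra.coeffLinearEquiv k).toLinearMap

theorem mulFunLevel_of (M : OpenNormalSubgroup G) (φ : G ⧸ M.toSubgroup → k)
    (N : OpenNormalSubgroup G) (g : G) :
    mulFunLevel M φ N (MonoidAlgebra.of k _ (QuotientGroup.mk g)) =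
      φ (QuotientGroup.mk g) • MonoidAlgebra.of k (G ⧸ N.toSubgroup) (QuotientGroup.mk g) := by
  simp only [mulFunLevel, LinearMap.comp_apply, MonoidAlgebra.of_apply]
  refine (Finsupp.linearCombination_single k _ _).trans ?_
  rw [one_smul]
  rfl

/-- Compatibility lets the level maps assemble to an endomorphism of `k⟦G⟧`. Only the image of `x`
at level `N ⊓ M` matters, so `x` may be replaced by a combination of group elements. -/
theorem mulFunLevel_transition (M : OpenNormalSubgroup G) (φ : G ⧸ M.toSubgroup → k)
    {N N' : OpenNormalSubgroup G} (h : N.toSubgroup ≤ N'.toSubgroup)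
    (x : CGA k G) : groupAlgTransition k G h (mulFunLevel M φ N (proj k G (N ⊓ M) x)) =
      mulFunLevel M φ N' (proj k G (N' ⊓ M) x) := by
  have h' : (N ⊓ M).toSubgroup ≤ (N' ⊓ M).toSubgroup := inf_le_inf_right M.toSubgroup h
  rw [← transition_proj h' x]
  obtain ⟨y, hy, e⟩ := exists_mem_span (N ⊓ M) x
  rw [← e]
  clear e
  induction hy using Submodule.span_induction with
  | mem y hy =>
    obtain ⟨g, rfl⟩ := hy
    rw [transition_proj, proj_of, proj_of, mulFunLevel_of, mulFunLevel_of, map_smul]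
    congr 1
    exact transition_proj h (of k g)
  | zero => simp
  | add x y _ _ hx hy => simp only [map_add, hx, hy]
  | smul c x _ hx => simp only [map_smul, hx]

theorem exists_mulFun (M : OpenNormalSubgroup G) (φ : G ⧸ M.toSubgroup → k) :
    ∃ e : CGA k G →ₗ[k] CGA k G, Continuous e ∧
      ∀ g : G, e (of k g) = φ (QuotientGroup.mk g) • of k g := by
  let e : CGA k G →ₗ[k] CGA k G :=
    { toFun := fun x => ⟨fun N => mulFunLevel M φ N (proj k G (N ⊓ M) x),
        fun N N' h => mulFunLevel_transition M φ h x⟩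
      map_add' := fun x y => ext_proj fun N => by
        change mulFunLevel M φ N (proj k G (N ⊓ M) (x + y)) =
          mulFunLevel M φ N (proj k G (N ⊓ M) x) + mulFunLevel M φ N (proj k G (N ⊓ M) y)
        rw [map_add, map_add]
      map_smul' := fun c x => ext_proj fun N => by
        change mulFunLevel M φ N (proj k G (N ⊓ M) (c • x)) =
          c • mulFunLevel M φ N (proj k G (N ⊓ M) x)
        rw [map_smul, map_smul] }
  have he : ∀ N x, proj k G N (e x) = mulFunLevel M φ N (proj k G (N ⊓ M) x) := fun _ _ => rfl
  refine ⟨e, continuous_of_proj _ fun N => ⟨N ⊓ M, fun x y h => by rw [he, he, h]⟩,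
    fun g => ext_proj fun N => ?_⟩
  rw [he, proj_of, mulFunLevel_of, map_smul, proj_of]

instance : T2Space (CGA k G) := by
  have : T1Space (CGA k G) := by
    refine IsTopologicalAddGroup.t1Space _ ?_
    rw [← closure_subset_iff_isClosed]
    intro x hx
    refine ext_proj fun N => ?_
    obtain ⟨y, hy, h⟩ := (mem_closure_iff_nhds_basis (nhds_hasBasis x)).1 hx N trivial
    rw [← show _ = _ from h, Set.mem_singleton_iff.1 hy]
  infer_instance

/-- The projection of `k⟦G⟧` onto `k⟦K⟧` for an open subgroup `K`. -/
theorem exists_restriction (K : Subgroup G) (M : OpenNormalSubgroup G) (h : M.toSubgroup ≤ K) :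
    ∃ e : CGA k G →ₗ[k] CGA k G, Continuous e ∧ (∀ g ∈ K, e (of k g) = of k g) ∧
      (∀ g ∉ K, e (of k g) = 0) ∧ (∀ a b, e (a * incl k K b) = e a * incl k K b) ∧
      (∀ g ∈ K, ∀ a, e (of k g * a) = of k g * e a) := by
  classical
  -- The indicator function of `K`, which descends to `G/M` since `M ≤ K`. The multiplicative
  -- identities are then checked on group elements: `g' g` and `g'` lie in `K` together when `g ∈
  -- K`.
  let φ : G ⧸ M.toSubgroup → k := fun x => if ∃ g ∈ K, QuotientGroup.mk g = x then 1 else 0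
  have hφ : ∀ g : G, (∃ g' ∈ K, (QuotientGroup.mk g' : G ⧸ M.toSubgroup) = QuotientGroup.mk g) ↔
      g ∈ K := fun g =>
    ⟨fun ⟨g', hg', e⟩ => by
      have := h (QuotientGroup.eq.1 e)
      rwa [K.mul_mem_cancel_left (K.inv_mem hg')] at this, fun hg => ⟨g, hg, rfl⟩⟩
  obtain ⟨e, he, h⟩ := exists_mulFun M φ
  have h1 : ∀ g ∈ K, e (of k g) = of k g := fun g hg => by
    rw [h, show φ _ = 1 from if_pos ((hφ g).2 hg), one_smul]
  have h0 : ∀ g ∉ K, e (of k g) = 0 := fun g hg => by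
    rw [h, show φ _ = 0 from if_neg fun hg' => hg ((hφ g).1 hg'), zero_smul]
  refine ⟨e, he, h1, h0, fun a b => ?_, fun g hg a => ?_⟩
  · refine induction_on (p := fun b => e (a * incl k K b) = e a * incl k K b)
      (isClosed_eq (he.comp (continuous_const.mul (continuous_incl K)))
        (continuous_const.mul (continuous_incl K))) (fun g => ?_) (by simp)
      (fun x y hx hy => by simp only [map_add, mul_add, hx, hy])
      (fun c x hx => by simp only [map_smul, mul_smul_comm, hx]) b
    refine induction_on (p := fun a => e (a * incl k K (of k g)) = e a * incl k K (of k g))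
      (isClosed_eq (he.comp (continuous_id.mul continuous_const))
        (he.mul continuous_const)) (fun g' => ?_) (by simp)
      (fun x y hx hy => by simp only [map_add, add_mul, hx, hy])
      (fun c x hx => by simp only [map_smul, smul_mul_assoc, hx]) a
    rw [incl_of, ← map_mul]
    by_cases hg' : g' ∈ K
    · rw [h1 _ hg', h1 _ (K.mul_mem hg' g.2), map_mul]
    · rw [h0 _ hg', h0 _ (fun hh => hg' ((K.mul_mem_cancel_right g.2).1 hh)), zero_mul]
  · refine induction_on (p := fun a => e (of k g * a) = of k g * e a)
      (isClosed_eq (he.comp (continuous_const.mul continuous_id))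
        (continuous_const.mul he)) (fun g' => ?_) (by simp)
      (fun x y hx hy => by simp only [map_add, mul_add, hx, hy])
      (fun c x hx => by simp only [map_smul, mul_smul_comm, hx]) a
    rw [← map_mul]
    by_cases hg' : g' ∈ K
    · rw [h1 _ hg', h1 _ (K.mul_mem hg hg'), map_mul]
    · rw [h0 _ hg', h0 _ (fun hh => hg' ((K.mul_mem_cancel_left hg).1 hh)), mul_zero]

end CGA

/-! ### The trace -/

theorem conjApply_mk {k G : Type u} [Field k] [Group G] [TopologicalSpace G] (K : Subgroup G)
    {U W : Type u} [AddCommGroup U] [Module (CGA k G) U] [TopologicalSpace U]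
    [AddCommGroup W] [Module (CGA k G) W] [TopologicalSpace W]
    (α : Res k K U →L[CGA k K] Res k K W) (u : U) (s : G) :
    conjApply k K α u (QuotientGroup.mk s) =
      CGA.of k s • (Res.mk k K W).symm (α (Res.mk k K U (CGA.of k s⁻¹ • u))) := rfl

section Trace

variable {k G : Type u} [Field k] [Group G] [TopologicalSpace G] (K : Subgroup G)
  {U W : Type u} [AddCommGroup U] [Module k U] [Module (CGA k G) U] [IsScalarTower k (CGA k G) U]
  [TopologicalSpace U] [ContinuousSMul (CGA k G) U]
  [AddCommGroup W] [Module k W] [Module (CGA k G) W] [IsScalarTower k (CGA k G) W]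
  [TopologicalSpace W] [IsTopologicalAddGroup W] [ContinuousSMul (CGA k G) W]

omit [IsTopologicalAddGroup W] in
/-- A continuous linear map commuting with `K` is `k⟦K⟧`-linear. -/
theorem Res.exists_clm [T2Space W] (θ : U →ₗ[k] W) (hθ : Continuous θ)
    (h : ∀ g ∈ K, ∀ u, θ (CGA.of k g • u) = CGA.of k g • θ u) :
    ∃ p : Res k K U →L[CGA k K] Res k K W, ∀ u, p (Res.mk k K U u) = Res.mk k K W (θ u) := by
  let θ' : Res k K U →ₗ[k] Res k K W :=
    { toFun := fun u => Res.mk k K W (θ ((Res.mk k K U).symm u))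
      map_add' := map_add θ
      map_smul' := map_smul θ }
  have hθ' : Continuous θ' := hθ
  refine ⟨⟨⟨⟨θ', map_add θ'⟩, CGA.map_smul_of_equivariant θ' hθ' fun g u => ?_⟩, hθ'⟩,
    fun u => rfl⟩
  obtain ⟨u, rfl⟩ := (Res.mk k K U).surjective u
  rw [Res.smul_mk, CGA.incl_of]
  refine (congrArg (Res.mk k K W) (h g g.2 u)).trans ?_
  rw [← CGA.incl_of, ← Res.smul_mk]
  rfl

/-- The trace of a `k⟦K⟧`-linear map is `k⟦G⟧`-linear. -/
theorem exists_traceCLM [Finite (G ⧸ K)] [T2Space W] (α : Res k K U →L[CGA k K] Res k K W) :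
    ∃ T : U →L[CGA k G] W, ∀ u, T u = traceMap k K α u := by
  have := Fintype.ofFinite (G ⧸ K)
  have hadd : ∀ u v x, conjApply k K α (u + v) x = conjApply k K α u x + conjApply k K α v x := by
    intro u v x
    obtain ⟨s, rfl⟩ := QuotientGroup.mk_surjective x
    simp only [conjApply_mk, smul_add, map_add]
  have hsmul : ∀ (c : k) u x, conjApply k K α (c • u) x = c • conjApply k K α u x := by
    intro c u x
    obtain ⟨s, rfl⟩ := QuotientGroup.mk_surjective x
    have := (α : Res k K U →ₗ[CGA k K] Res k K W).map_smul_of_tower c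
      (Res.mk k K U (CGA.of k s⁻¹ • u))
    rw [conjApply_mk, conjApply_mk, smul_comm, ← smul_comm (CGA.of k s)]
    exact congrArg (fun w : Res k K W => CGA.of k s • (Res.mk k K W).symm w) this
  have hcont : ∀ x, Continuous fun u => conjApply k K α u x := by
    intro x
    obtain ⟨s, rfl⟩ := QuotientGroup.mk_surjective x
    have h : Continuous fun u : U => Res.mk k K U (CGA.of k s⁻¹ • u) :=
      continuous_const_smul (CGA.of k s⁻¹)
    have h' : Continuous fun w : Res k K W => CGA.of k s • (Res.mk k K W).symm w :=
      continuous_const_smul (T := W) (CGA.of k s)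
    exact h'.comp (α.continuous.comp h)
  -- From `s α s⁻¹ g = g (g⁻¹ s) α (g⁻¹ s)⁻¹`, translating `u` by `g` merely permutes the cosets in
  -- the sum.
  have hG : ∀ (g : G) u x, conjApply k K α (CGA.of k g • u) x =
      CGA.of k g • conjApply k K α u (g⁻¹ • x) := by
    intro g u x
    obtain ⟨s, rfl⟩ := QuotientGroup.mk_surjective x
    change _ = CGA.of k g • conjApply k K α u (QuotientGroup.mk (g⁻¹ * s))
    rw [conjApply_mk, conjApply_mk, smul_smul, smul_smul, ← map_mul, ← map_mul]
    simp
  have htr : ∀ u, traceMap k K α u = ∑ x, conjApply k K α u x :=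
    fun u => finsum_eq_sum_of_fintype _
  let T : U →ₗ[k] W :=
    { toFun := fun u => ∑ x, conjApply k K α u x
      map_add' := fun u v => by simp only [hadd, Finset.sum_add_distrib]
      map_smul' := fun c u => by simp only [hsmul, Finset.smul_sum, RingHom.id_apply] }
  have hT : Continuous T := continuous_finsetSum _ fun x _ => hcont x
  refine ⟨⟨⟨⟨T, map_add T⟩, CGA.map_smul_of_equivariant T hT fun g u => ?_⟩, hT⟩,
    fun u => (htr u).symm⟩
  change ∑ x, _ = CGA.of k g • ∑ x, _
  simp only [hG, Finset.smul_sum]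
  exact Fintype.sum_equiv (MulAction.toPerm g⁻¹) _ _ fun x => rfl

/-- The natural projection from the module induced from an open subgroup is a trace. -/
theorem exists_traceMap_eq_naturalProj [IsTopologicalGroup G] [CompactSpace G]
    (M : OpenNormalSubgroup G) (hM : M.toSubgroup ≤ K) [IsTopologicalAddGroup U]
    [IsPseudocompactModule k (CGA k G) U] :
    ∃ p : Res k K (Ind k K (Res k K U)) →L[CGA k K] Res k K U,
      ∀ x, traceMap k K p x = naturalProj k K U x := by
  have : Finite (G ⧸ K) := Subgroup.quotient_finite_of_isOpen K (Subgroup.isOpen_mono hM M.isOpen')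
  have : T2Space U := IsPseudocompactModule.t2Space k (CGA k G)
  obtain ⟨e, he, h1, h0, hmul, hmul'⟩ := CGA.exists_restriction (k := k) K M hM
  let r : Res k K U →ₗ[k] U := { toFun := (Res.mk k K U).symm, map_add' := fun _ _ => rfl,
                                 map_smul' := fun _ _ => rfl }
  have hr : Continuous r := continuous_id
  -- `θ(a ⊗ u) = e(a) u` keeps only the summand of the trivial coset and then lets `k⟦K⟧` act.
  obtain ⟨θ, hθ, h⟩ := Ind.exists_smul_extension e he hmul r hr (fun _ _ => rfl)
  have hθk : ∀ (c : k) x, θ (c • x) = c • θ x := by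
    intro c x
    have hc : ∀ u : U, algebraMap k (CGA k G) c • u = c • u :=
      fun u => algebraMap_smul (CGA k G) c u
    refine (CompletedTensor.addHom_ext
      (θ.comp (DistribSMul.toAddMonoidHom _ (algebraMap k (CGA k G) c)))
      ((DistribSMul.toAddMonoidHom U (algebraMap k (CGA k G) c)).comp θ)
      (hθ.comp (continuous_const_smul _))
      ((continuous_const_smul _).comp hθ) (fun b v => ?_) x).trans (hc _)
    change θ (algebraMap k (CGA k G) c • CompletedTensor.tmul _ _ b v) =
      algebraMap k (CGA k G) c • θ (CompletedTensor.tmul _ _ b v)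
    rw [CompletedTensor.smul_tmul, h, h, ← Algebra.smul_def, map_smul, hc, smul_assoc]
  have hθK : ∀ g ∈ K, ∀ x, θ (CGA.of k g • x) = CGA.of k g • θ x := by
    intro g hg x
    refine CompletedTensor.addHom_ext (θ.comp (DistribSMul.toAddMonoidHom _ (CGA.of k g)))
      ((DistribSMul.toAddMonoidHom U (CGA.of k g)).comp θ) (hθ.comp (continuous_const_smul _))
      ((continuous_const_smul _).comp hθ) (fun b v => ?_) x
    change θ (CGA.of k g • CompletedTensor.tmul _ _ b v) =
      CGA.of k g • θ (CompletedTensor.tmul _ _ b v)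
    rw [CompletedTensor.smul_tmul, h, h, hmul' g hg, mul_smul]
  obtain ⟨p, hp⟩ := Res.exists_clm K (⟨⟨θ, map_add θ⟩, hθk⟩ : Ind k K (Res k K U) →ₗ[k] U) hθ hθK
  obtain ⟨T, hT⟩ := exists_traceCLM K p
  refine ⟨p, fun x => ?_⟩
  rw [← hT]
  refine DFunLike.congr_fun (Ind.clm_ext T (naturalProj k K U) fun u => ?_) x
  rw [hT]
  -- On `1 ⊗ u` the term of `s` is `s e(s⁻¹) u`, which vanishes unless `s ∈ K`; the trivial coset
  -- contributes `u`, the value of the natural projection.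
  have hpu : ∀ s : G, conjApply k K p (CompletedTensor.tmul (CGA.incl k K) (Res k K U) 1 u)
      (QuotientGroup.mk s) = CGA.of k s • e (CGA.of k s⁻¹) • (Res.mk k K U).symm u := by
    intro s
    rw [conjApply_mk, CompletedTensor.smul_tmul, mul_one]
    exact congrArg (CGA.of k s • ·) ((hp _).trans (h _ _))
  rw [traceMap, finsum_eq_single _ (QuotientGroup.mk 1), hpu, inv_one, h1 1 K.one_mem, map_one,
    one_smul, one_smul]
  · exact ((naturalProj_tmul k K 1 ((Res.mk k K U).symm u)).trans (one_smul _ _)).symm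
  · intro x hx
    obtain ⟨s, rfl⟩ := QuotientGroup.mk_surjective x
    rw [hpu, h0, zero_smul, smul_zero]
    intro hs
    exact hx (QuotientGroup.eq.2 (by simpa using hs))

/-- Since the splitting `s` commutes with `G`, `Tr(p s) = Tr(p) s`, and this is the natural
projection after `s`, hence the identity. -/
theorem exists_traceMap_eq_self [IsTopologicalGroup G] [CompactSpace G]
    (M : OpenNormalSubgroup G) (hM : M.toSubgroup ≤ K) [IsTopologicalAddGroup U]
    [IsPseudocompactModule k (CGA k G) U] (h : Splits (naturalProj k K U)) :
    ∃ α : Res k K U →L[CGA k K] Res k K U, ∀ u, traceMap k K α u = u := by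
  obtain ⟨p, hp⟩ := exists_traceMap_eq_naturalProj (k := k) (U := U) K M hM
  obtain ⟨s, hs⟩ := h
  let s₀ : Res k K U →L[CGA k K] Res k K (Ind k K (Res k K U)) :=
    ⟨⟨⟨fun u => Res.mk k K _ (s ((Res.mk k K U).symm u)), fun u v => map_add s _ _⟩,
      fun b u => map_smul s _ _⟩, s.continuous⟩
  refine ⟨p.comp s₀, fun u => ?_⟩
  refine Eq.trans ?_ ((hp (s u)).trans (hs u))
  refine finsum_congr fun x => ?_
  obtain ⟨g, rfl⟩ := QuotientGroup.mk_surjective x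
  rw [conjApply_mk, conjApply_mk, ← map_smul s]
  rfl

end Trace

/-! ### Relative projectivity of the coinvariants -/

section Coinvariants

variable {k G : Type u} [Field k] [Group G] [TopologicalSpace G] {K : Subgroup G}
  {U W : Type u} [AddCommGroup U] [Module k U] [Module (CGA k G) U] [IsScalarTower k (CGA k G) U]
  [TopologicalSpace U]
  [AddCommGroup W] [Module k W] [Module (CGA k G) W] [IsScalarTower k (CGA k G) W]
  [TopologicalSpace W]

/-- A `k⟦K⟧`-linear map, as a linear map commuting with `K`. -/
theorem Res.exists_linearMap (ψ : Res k K U →L[CGA k K] Res k K W) :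
    ∃ θ : U →ₗ[k] W, Continuous θ ∧ (∀ g ∈ K, ∀ u, θ (CGA.of k g • u) = CGA.of k g • θ u) ∧
      ∀ u, θ u = (Res.mk k K W).symm (ψ (Res.mk k K U u)) := by
  refine ⟨⟨⟨fun u => (Res.mk k K W).symm (ψ (Res.mk k K U u)), map_add ψ⟩,
    fun c u => (ψ : Res k K U →ₗ[CGA k K] Res k K W).map_smul_of_tower c (Res.mk k K U u)⟩, ψ.continuous, fun g hg u => ?_,
    fun u => rfl⟩
  have := map_smul ψ (CGA.of k (⟨g, hg⟩ : K)) (Res.mk k K U u)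
  rw [Res.smul_mk, CGA.incl_of] at this
  refine (congrArg (Res.mk k K W).symm this).trans ?_
  rw [Res.mk_symm_smul, CGA.incl_of]
  rfl

variable [IsTopologicalAddGroup U] [ContinuousSMul (CGA k G) U]

omit [IsTopologicalAddGroup U] in
-- A lift over `k⟦K⟧` is in particular a lift over `k⟦H⟧`, so the larger subgroup poses fewer
-- lifting problems.
theorem RelProjective.mono {H : Subgroup G} (hHK : H ≤ K) (h : RelProjective k H U) :
    RelProjective k K U := by
  intro V W _ _ _ _ _ _ _ _ _ _ _ _ _ _ _ _ β φ hβ ⟨ψ, hψ⟩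
  have : T2Space V := IsPseudocompactModule.t2Space k (CGA k G)
  obtain ⟨θ, hθ, hK, he⟩ := Res.exists_linearMap ψ
  obtain ⟨ψ', hψ'⟩ := Res.exists_clm H θ hθ fun g hg => hK g (hHK hg)
  refine h V W β φ hβ ⟨ψ', fun u => ?_⟩
  rw [hψ', AddEquiv.symm_apply_apply, he]
  exact hψ u

omit [Module k U] [IsScalarTower k (CGA k G) U] in
theorem mkQ_of_smul (N : Subgroup G) {n : G} (hn : n ∈ N) (u : U) :
    (augSubmodule k N U).mkQ (CGA.of k n • u) = (augSubmodule k N U).mkQ u := by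
  refine (Submodule.Quotient.eq _).2 (subset_closure (Submodule.subset_span ?_))
  refine ⟨CGA.of k (⟨n, hn⟩ : N) - 1, ?_, u, ?_⟩
  · rw [map_sub, CGA.augmentation_of, map_one, sub_self]
  · rw [map_sub, map_one, CGA.incl_of, sub_smul, one_smul]

omit [IsTopologicalAddGroup U] in
-- On a vector fixed by `N` the algebra `k⟦N⟧` acts through its augmentation: this holds for group
-- elements and passes to the closure of their span.
theorem incl_smul_eq_zero [T2Space U] (N : Subgroup G) {v : U} (hv : ∀ n ∈ N, CGA.of k n • v = v)
    {i : CGA k N} (hi : CGA.augmentation k N i = 0) : CGA.incl k N i • v = 0 := by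
  have key := CGA.induction_on
    (p := fun i : CGA k N => CGA.incl k N i • v = CGA.augmentation k N i • v) ?_
    (fun g => ?_) (by simp) (fun x y hx hy => ?_) (fun c x hx => ?_) i
  · rw [key, hi, zero_smul]
  · rw [← isOpen_compl_iff, isOpen_iff_mem_nhds]
    intro x hx
    have hc : Continuous fun y : CGA k N => CGA.incl k N y • v :=
      (CGA.continuous_incl N).smul continuous_const
    filter_upwards [CGA.eventually_augmentation_eq x,
      (isOpen_ne_fun hc continuous_const).mem_nhds
        (show CGA.incl k N x • v ≠ CGA.augmentation k N x • v from hx)] with y h1 h2 h3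
    exact h2 (h1 ▸ h3)
  · rw [CGA.incl_of, CGA.augmentation_of, one_smul, hv g g.2]
  · rw [map_add, map_add, add_smul, add_smul, hx, hy]
  · rw [map_smul, map_smul, smul_assoc, smul_assoc, hx]

/-- If the identity of `U` is a trace from `K`, then the coinvariants under a normal subgroup
contained in `K` are relatively `K`-projective. -/
theorem relProjective_coinvariants_of_trace [Finite (G ⧸ K)] (N : Subgroup G) [N.Normal]
    (hNK : N ≤ K) (α : Res k K U →L[CGA k K] Res k K U) (hα : ∀ u, traceMap k K α u = u) :
    RelProjective k K (Coinvariants k N U) := by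
  intro V W _ _ _ _ _ _ _ _ _ _ _ _ _ _ _ _ β φ _ ⟨ψ, hψ⟩
  have : T2Space V := IsPseudocompactModule.t2Space k (CGA k G)
  have := Fintype.ofFinite (G ⧸ K)
  obtain ⟨a, ha, haK, hae⟩ := Res.exists_linearMap α
  obtain ⟨θ, hθ, hθK, hθe⟩ := Res.exists_linearMap ψ
  let q : U →L[CGA k G] Coinvariants k N U := ⟨(augSubmodule k N U).mkQ, continuous_quot_mk⟩
  have hq : ∀ n ∈ N, ∀ u, q (CGA.of k n • u) = q u := fun n hn u => mkQ_of_smul N hn u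
  let qk : U →ₗ[k] Coinvariants k N U := (augSubmodule k N U).mkQ.restrictScalars k
  have hqk : Continuous qk := q.continuous
  -- `ρ = ψ q α` is defined on `U`, where `α` lives; its trace `T` must be shown to descend to the
  -- coinvariants.
  obtain ⟨ρ, hρ⟩ := Res.exists_clm K (θ ∘ₗ qk ∘ₗ a) (hθ.comp (hqk.comp ha)) (fun g hg u => by
      change θ (q (a _)) = _ • θ (q (a u))
      rw [haK g hg, map_smul, hθK g hg])
  obtain ⟨T, hT⟩ := exists_traceCLM K ρ
  have hconj : ∀ u (s : G), conjApply k K ρ u (QuotientGroup.mk s) =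
      CGA.of k s • θ (q (a (CGA.of k s⁻¹ • u))) := fun u s => by
    rw [conjApply_mk, hρ]
    rfl
  -- Normality moves `n` past `s⁻¹` as a conjugate in `N ≤ K`; it commutes with `α` and is absorbed
  -- by `q`.
  have hTN : ∀ n ∈ N, ∀ u, CGA.of k n • T u = T u := by
    intro n hn u
    rw [← map_smul, hT, hT]
    refine finsum_congr fun x => ?_
    obtain ⟨s, rfl⟩ := QuotientGroup.mk_surjective x
    have hn' : s⁻¹ * n * s ∈ N := by
      simpa using (inferInstance : N.Normal).conj_mem n hn s⁻¹
    have e : CGA.of k s⁻¹ • CGA.of k n • u = CGA.of k (s⁻¹ * n * s) • CGA.of k s⁻¹ • u := by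
      simp only [smul_smul, ← map_mul]
      simp
    rw [hconj, hconj, e, haK _ (hNK hn'), hq _ hn']
  have hker : augSubmodule k N U ≤ LinearMap.ker (T : U →ₗ[CGA k G] V) := by
    refine Submodule.topologicalClosure_minimal _ (Submodule.span_le.2 ?_) ?_
    · rintro _ ⟨i, hi, u, rfl⟩
      refine LinearMap.mem_ker.2 ((map_smul T _ _).trans ?_)
      exact incl_smul_eq_zero N (fun n hn => hTN n hn u) hi
    · exact isClosed_eq T.continuous continuous_const
  refine ⟨⟨(augSubmodule k N U).liftQ T hker, T.continuous.quotient_lift _⟩, fun x => ?_⟩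
  obtain ⟨u, rfl⟩ := Submodule.Quotient.mk_surjective _ x
  change β (T u) = φ (q u)
  -- Termwise, `β s ψ q α s⁻¹ u = φ q s α s⁻¹ u`; summed over cosets the right side is `φ q Tr(α)
  -- u`.
  conv_rhs => rw [← hα u]
  rw [hT, traceMap, traceMap, finsum_eq_sum_of_fintype, finsum_eq_sum_of_fintype, map_sum, map_sum,
    map_sum]
  refine Finset.sum_congr rfl fun x _ => ?_
  obtain ⟨s, rfl⟩ := QuotientGroup.mk_surjective x
  rw [hconj, conjApply_mk, map_smul β, map_smul q, map_smul φ, ← hae, hθe]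
  exact congrArg _ (hψ _)

end Coinvariants

/-! ### Generalized limits -/

/-- A linear analogue of a Banach limit over an arbitrary field. Formal combinations of indices
whose values are eventually constant form a subspace `R`, on which the limit is a linear functional.
A linear extension to all combinations still respects every linear relation that holds eventually,
since such a relation is an element of `R` with limit `0`. -/
theorem exists_generalized_limit {k X Y : Type*} [Field k] (l : Filter X) [l.NeBot]
    (e : X → Y → k) : ∃ b : Y → k, (∀ y c, (∀ᶠ x in l, e x y = c) → b y = c) ∧
      ∀ y y₁ y₂ s, (∀ᶠ x in l, e x y = s * e x y₁ + e x y₂) → b y = s * b y₁ + b y₂ := by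
  let E : X → (Y →₀ k) →ₗ[k] k := fun x => Finsupp.linearCombination k (e x)
  let R : Submodule k (Y →₀ k) :=
    { carrier := {r | ∃ c, ∀ᶠ x in l, E x r = c}
      add_mem' := by
        rintro r r' ⟨c, hc⟩ ⟨c', hc'⟩
        refine ⟨c + c', ?_⟩
        filter_upwards [hc, hc'] with x h h'
        rw [map_add, h, h']
      zero_mem' := ⟨0, Filter.Eventually.of_forall fun x => map_zero _⟩
      smul_mem' := by
        rintro s r ⟨c, hc⟩
        refine ⟨s * c, ?_⟩
        filter_upwards [hc] with x h
        rw [map_smul, h, smul_eq_mul] }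
  choose g hg using fun r : R => r.2
  have uniq : ∀ {c c' : k} {r : Y →₀ k}, (∀ᶠ x in l, E x r = c) → (∀ᶠ x in l, E x r = c') →
      c = c' := fun h h' => by
    obtain ⟨x, hx, hx'⟩ := (h.and h').exists
    exact hx.symm.trans hx'
  let g' : R →ₗ[k] k :=
    { toFun := g
      map_add' := fun r r' => uniq (hg (r + r')) (by
        filter_upwards [hg r, hg r'] with x h h'
        rw [Submodule.coe_add, map_add, h, h'])
      map_smul' := fun s r => uniq (hg (s • r)) (by
        filter_upwards [hg r] with x h
        rw [Submodule.coe_smul, map_smul, h]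
        rfl) }
  obtain ⟨b, hb⟩ := LinearMap.exists_extend g'
  have hb' : ∀ r c, (∀ᶠ x in l, E x r = c) → b r = c := fun r c h =>
    (DFunLike.congr_fun hb ⟨r, c, h⟩).trans (uniq (hg ⟨r, c, h⟩) h)
  refine ⟨fun y => b (Finsupp.single y 1), fun y c h => hb' _ _ ?_, fun y y₁ y₂ s h => ?_⟩
  · filter_upwards [h] with x hx
    simpa [E] using hx
  · have := hb' (Finsupp.single y 1 - (s • Finsupp.single y₁ 1 + Finsupp.single y₂ 1)) 0 (by
      filter_upwards [h] with x hx
      simp only [E, map_sub, map_add, map_smul, Finsupp.linearCombination_single,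
        smul_eq_mul]
      rw [hx]
      ring)
    rw [map_sub, map_add, map_smul, sub_eq_zero] at this
    exact this

/-! ### Lifting from the coinvariants -/

section Lifting

/-- `U ⧸ C` is generated by finitely many elements killed by `I`, so it is a quotient of `(A ⧸ I)ⁿ`.
-/
theorem finite_quotient_of_smul_mem {k A U : Type*} [Field k] [Ring A] [Algebra k A]
    [AddCommGroup U] [Module k U] [Module A U] [IsScalarTower k A U] [Module.Finite A U]
    (I : Ideal A) [Module.Finite k (A ⧸ I)] (C : Submodule A U)
    (h : ∀ a ∈ I, ∀ u : U, a • u ∈ C) : Module.Finite k (U ⧸ C) := by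
  obtain ⟨n, s, hs⟩ := Module.Finite.exists_fin (R := A) (M := U ⧸ C)
  let f : Fin n → (A ⧸ I) →ₗ[A] U ⧸ C := fun i =>
    I.liftQ (LinearMap.toSpanSingleton A (U ⧸ C) (s i)) fun a ha => by
      obtain ⟨u, hu⟩ := Submodule.Quotient.mk_surjective C (s i)
      rw [LinearMap.mem_ker, LinearMap.toSpanSingleton_apply, ← hu, ← Submodule.Quotient.mk_smul]
      exact (Submodule.Quotient.mk_eq_zero C).2 (h a ha u)
  let F : (Fin n → A ⧸ I) →ₗ[A] U ⧸ C := LinearMap.lsum A (fun _ => A ⧸ I) ℕ f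
  have hF : Function.Surjective F := by
    rw [← LinearMap.range_eq_top, eq_top_iff, ← hs, Submodule.span_le]
    rintro _ ⟨i, rfl⟩
    refine ⟨Pi.single i (Submodule.Quotient.mk 1), ?_⟩
    simp only [F, LinearMap.lsum_piSingle]
    exact one_smul A (s i)
  exact Module.Finite.of_surjective (F.restrictScalars k) hF

variable {k G : Type u} [Field k] [Group G] [TopologicalSpace G]
  {U : Type u} [AddCommGroup U] [Module k U] [Module (CGA k G) U]
  [IsScalarTower k (CGA k G) U] [TopologicalSpace U] [IsTopologicalAddGroup U]
  [ContinuousSMul (CGA k G) U]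
  {V : Type u} [AddCommGroup V] [Module k V] [Module (CGA k G) V]
  [IsScalarTower k (CGA k G) V] [TopologicalSpace V] [IsTopologicalAddGroup V]
  [ContinuousSMul (CGA k G) V]
  {W : Type u} [AddCommGroup W] [Module k W] [Module (CGA k G) W]
  [IsScalarTower k (CGA k G) W] [TopologicalSpace W] [IsTopologicalAddGroup W]
  [ContinuousSMul (CGA k G) W]

omit [Module k W] [IsScalarTower k (CGA k G) W] [IsTopologicalAddGroup W]
  [ContinuousSMul (CGA k G) W] in
/-- If the coinvariants are relatively projective then lifts exist modulo open submodules. -/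
theorem exists_lift_mod [IsPseudocompactModule k (CGA k G) U] (H : Subgroup G)
    (h : ∀ N : OpenNormalSubgroup G,
      RelProjective k (H ⊔ N.toSubgroup) (Coinvariants k N.toSubgroup U))
    (β : V →L[CGA k G] W) (φ : U →L[CGA k G] W)
    (ψ : U →ₗ[k] V) (hψ : Continuous ψ) (hH : ∀ g ∈ H, ∀ u, ψ (CGA.of k g • u) = CGA.of k g • ψ u)
    (hβ : ∀ u, β (ψ u) = φ u) (V' : OpenFinSubmodule k (CGA k G) V) :
    ∃ θ : U →L[CGA k G] V ⧸ V'.1, ∀ u v, Submodule.Quotient.mk v = θ u →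
      v - ψ u ∈ V'.1 ⊔ LinearMap.ker (β : V →ₗ[CGA k G] W) := by
  obtain ⟨U', hU'⟩ := IsPseudocompactModule.exists_le (k := k) (A := CGA k G)
    ((V'.2.1.preimage hψ).mem_nhds (by simp))
  -- `N` must serve twice: acting trivially on `U ⧸ U'` it lets `ψ` modulo `V'` factor through the
  -- coinvariants, and acting trivially on `V ⧸ V'` it turns `H`-equivariance into
  -- `HN`-equivariance.
  obtain ⟨N, hN⟩ := CGA.exists_projKer_le
    (I := Module.annihilator (CGA k G) (U ⧸ U'.1) ⊓ Module.annihilator (CGA k G) (V ⧸ V'.1))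
    ((isOpen_annihilator k U').inter (isOpen_annihilator k V'))
  have hNU : ∀ a ∈ CGA.projKer k N, ∀ u : U, a • u ∈ U'.1 := fun a ha u =>
    (Submodule.Quotient.mk_eq_zero _).1 (Module.mem_annihilator.1 (hN ha).1 (U'.1.mkQ u))
  have hNV : ∀ a ∈ CGA.projKer k N, ∀ v : V, a • v ∈ V'.1 := fun a ha v =>
    (Submodule.Quotient.mk_eq_zero _).1 (Module.mem_annihilator.1 (hN ha).2 (V'.1.mkQ v))
  have haug : augSubmodule k N.toSubgroup U ≤ U'.1 := by
    refine Submodule.topologicalClosure_minimal _ (Submodule.span_le.2 ?_)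
      (U'.1.toAddSubgroup.isClosed_of_isOpen U'.2.1)
    rintro _ ⟨i, hi, u, rfl⟩
    exact hNU _ (CGA.incl_mem_projKer N i hi) u
  have := V'.2.2
  have : DiscreteTopology (V ⧸ V'.1) := V'.1.discreteTopology_quotient V'.2.1
  -- The target `W` is replaced by the discrete, finite-dimensional quotient `V ⧸ (V' + ker β)`,
  -- which avoids asking whether the image of `V'` in `W` is open.
  let K : Submodule (CGA k G) V := V'.1 ⊔ LinearMap.ker (β : V →ₗ[CGA k G] W)
  have hVK : V'.1 ≤ K := le_sup_left
  have hK : IsOpen (K : Set V) :=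
    AddSubgroup.isOpen_mono (H₁ := V'.1.toAddSubgroup) (H₂ := K.toAddSubgroup) hVK V'.2.1
  have : DiscreteTopology (V ⧸ K) := K.discreteTopology_quotient hK
  have : FiniteDimensional k (V ⧸ K) := OpenFinSubmodule.finite_of_le hVK
  have : IsPseudocompactModule k (CGA k G) (V ⧸ V'.1) := isPseudocompactModule_of_discrete
  have : IsPseudocompactModule k (CGA k G) (V ⧸ K) := isPseudocompactModule_of_discrete
  let ψ₀ : Coinvariants k N.toSubgroup U →ₗ[k] V ⧸ V'.1 :=
    { toFun := Quotient.lift (fun u => V'.1.mkQ (ψ u)) (fun u v huv => by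
        have := haug ((Submodule.quotientRel_def _).1 huv)
        refine (Submodule.Quotient.eq V'.1).2 ?_
        rw [← map_sub]
        exact hU' this)
      map_add' := by
        rintro ⟨u⟩ ⟨v⟩
        exact congrArg V'.1.mkQ (map_add ψ u v)
      map_smul' := by
        rintro c ⟨u⟩
        exact congrArg V'.1.mkQ (map_smul ψ c u) }
  have hψ₀ : ∀ u, ψ₀ ((augSubmodule k N.toSubgroup U).mkQ u) = V'.1.mkQ (ψ u) := fun u => rfl
  have hψ₀c : Continuous ψ₀ :=
    Continuous.quotient_lift ((continuous_quot_mk : Continuous V'.1.mkQ).comp hψ) _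
  have hNψ : ∀ n ∈ N.toSubgroup, ∀ v : V ⧸ V'.1, CGA.of k n • v = v := by
    intro n hn v
    obtain ⟨v, rfl⟩ := V'.1.mkQ_surjective v
    refine (Submodule.Quotient.eq V'.1).2 ?_
    have := hNV _ (CGA.of_sub_one_mem_projKer (k := k) hn) v
    rwa [sub_smul, one_smul] at this
  have hHN : ∀ g ∈ H ⊔ N.toSubgroup, ∀ x, ψ₀ (CGA.of k g • x) = CGA.of k g • ψ₀ x := by
    intro g hg x
    obtain ⟨h, hh, n, hn, rfl⟩ := Subgroup.mem_sup_of_normal_right.1 hg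
    obtain ⟨u, rfl⟩ := (augSubmodule k N.toSubgroup U).mkQ_surjective x
    rw [map_mul, mul_smul, mul_smul, ← map_smul _ (CGA.of k n), mkQ_of_smul _ hn,
      ← map_smul (augSubmodule k N.toSubgroup U).mkQ, hψ₀, hH h hh, map_smul, ← hψ₀, hNψ n hn]
  obtain ⟨ψ₁, hψ₁⟩ := Res.exists_clm _ ψ₀ hψ₀c hHN
  let φ₀ : U →ₗ[CGA k G] V ⧸ K :=
    { toFun := fun u => K.mkQ (ψ u)
      map_add' := fun u v => by rw [map_add, map_add]
      map_smul' := fun a u => by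
        rw [RingHom.id_apply, ← map_smul]
        -- `ψ` is not `k⟦G⟧`-linear, but `β ψ = φ` is, so the defect of `ψ` lies in `ker β`.
        refine (Submodule.Quotient.eq K).2 (Submodule.mem_sup_right (LinearMap.mem_ker.2 ?_))
        change β (ψ (a • u) - a • ψ u) = 0
        rw [map_sub, map_smul β, hβ, hβ, map_smul φ, sub_self] }
  let φ₁ : Coinvariants k N.toSubgroup U →L[CGA k G] V ⧸ K :=
    ⟨(augSubmodule k N.toSubgroup U).liftQ φ₀ (fun u hu => LinearMap.mem_ker.2
      ((Submodule.Quotient.mk_eq_zero K).2 (hVK (hU' (haug hu))))),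
      Continuous.quotient_lift ((continuous_quot_mk : Continuous K.mkQ).comp hψ) _⟩
  obtain ⟨θ, hθ⟩ := h N (V ⧸ V'.1) (V ⧸ K) ⟨Submodule.factor hVK, continuous_of_discreteTopology⟩
    φ₁ (Submodule.factor_surjective hVK) ⟨ψ₁, fun x => by
      rw [hψ₁]
      obtain ⟨u, rfl⟩ := (augSubmodule k N.toSubgroup U).mkQ_surjective x
      rfl⟩
  refine ⟨θ.comp ⟨(augSubmodule k N.toSubgroup U).mkQ, continuous_quot_mk⟩, fun u v huv => ?_⟩
  have := hθ ((augSubmodule k N.toSubgroup U).mkQ u)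
  rw [show θ _ = _ from huv.symm] at this
  exact (Submodule.Quotient.eq K).1 this

omit [IsTopologicalAddGroup W] [ContinuousSMul (CGA k G) W] in
/-- Lifts modulo open submodules give a lift, if the module is finitely generated. -/
theorem exists_lift_of_exists_lift_mod [IsTopologicalGroup G] [CompactSpace G]
    [IsPseudocompactModule k (CGA k G) U] [IsPseudocompactModule k (CGA k G) V]
    [IsPseudocompactModule k (CGA k G) W] [Module.Finite (CGA k G) U]
    (β : V →L[CGA k G] W) (φ : U →L[CGA k G] W) (ψ : U → V) (hβ : ∀ u, β (ψ u) = φ u)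
    (h : ∀ V' : OpenFinSubmodule k (CGA k G) V,
      ∃ θ : U →L[CGA k G] V ⧸ V'.1, ∀ u v, Submodule.Quotient.mk v = θ u →
        v - ψ u ∈ V'.1 ⊔ LinearMap.ker (β : V →ₗ[CGA k G] W)) :
    ∃ ψ' : U →L[CGA k G] V, ∀ u, β (ψ' u) = φ u := by
  choose θ hθ using h
  choose t ht using fun V' u => Submodule.Quotient.mk_surjective _ (θ V' u)
  have htθ : ∀ {V₁ V₂ : OpenFinSubmodule k (CGA k G) V} (h : V₁ ≤ V₂) u,
      V₂.1.mkQ (t V₁ u) = Submodule.factor h (θ V₁ u) := fun h u => by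
    rw [← ht]
    rfl
  -- Along `atBot` the submodules shrink. If `ξ` factors through `V ⧸ V'`, then for `V'' ≤ V'` the
  -- value `ξ (t V'' u)` depends only on `θ V'' u`, hence linearly on `u` despite the arbitrary
  -- representatives `t`. For a general `ξ` only linearity in `ξ` is available.
  obtain ⟨b, hb, hb'⟩ := exists_generalized_limit
    (Filter.atBot : Filter (OpenFinSubmodule k (CGA k G) V))
    (fun V' (y : U × Module.Dual k V) => y.2 (t V' y.1))
  let B : U → Module.Dual k (Module.Dual k V) := fun u =>
    { toFun := fun ξ => b (u, ξ)
      map_add' := fun ξ η => by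
        have := hb' (u, ξ + η) (u, ξ) (u, η) 1 (Filter.Eventually.of_forall fun V' => by
          rw [one_mul]
          rfl)
        rwa [one_mul] at this
      map_smul' := fun s ξ => by
        have h0 := hb (u, 0) 0 (Filter.Eventually.of_forall fun V' => rfl)
        have := hb' (u, s • ξ) (u, ξ) (u, 0) s (Filter.Eventually.of_forall fun V' => by
          change s * _ = s * _ + 0
          rw [add_zero])
        rwa [h0, add_zero] at this }
  let q : ∀ V' : OpenFinSubmodule k (CGA k G) V, V →ₗ[k] V ⧸ V'.1 :=
    fun V' => V'.1.mkQ.restrictScalars k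
  have mem_iff : ∀ (V' : OpenFinSubmodule k (CGA k G) V) (v : V), v ∈ V'.1 ↔
      ∀ ξ : Module.Dual k (V ⧸ V'.1), ξ (q V' v) = 0 := fun V' v => by
    rw [Module.forall_dual_apply_eq_zero_iff]
    exact (Submodule.Quotient.mk_eq_zero V'.1).symm
  -- On functionals from `V ⧸ V'` the limit is an element of the double dual, hence evaluation at a
  -- class by finite dimension. These classes are compatible, and completeness of `V` supplies `v`.
  have hex : ∀ u, ∃ v : V, ∀ V' (ξ : Module.Dual k (V ⧸ V'.1)), ξ (q V' v) = b (u, ξ ∘ₗ q V') := by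
    intro u
    have : ∀ V' : OpenFinSubmodule k (CGA k G) V, ∃ y : V,
        ∀ ξ : Module.Dual k (V ⧸ V'.1), ξ (q V' y) = b (u, ξ ∘ₗ q V') := fun V' => by
      have := V'.2.2
      obtain ⟨y, hy⟩ := V'.1.mkQ_surjective
        ((Module.evalEquiv k (V ⧸ V'.1)).symm (B u ∘ₗ (q V').dualMap))
      refine ⟨y, fun ξ => ?_⟩
      change ξ (V'.1.mkQ y) = _
      rw [hy, Module.apply_evalEquiv_symm_apply]
      rfl
    choose y hy using this
    obtain ⟨v, hv⟩ := IsPseudocompactModule.exists_of_compatible (k := k) (A := CGA k G) y (by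
      intro V₁ V₂ h
      refine (mem_iff _ _).2 fun ξ => ?_
      have := hy V₁ (ξ ∘ₗ (Submodule.factor h).restrictScalars k)
      rw [map_sub, map_sub, hy V₂, sub_eq_zero]
      exact this)
    refine ⟨v, fun V' ξ => ?_⟩
    rw [← hy, ← sub_eq_zero, ← map_sub, ← map_sub]
    exact (mem_iff _ _).1 (hv V') ξ
  choose ψ' hψ' using hex
  have ext : ∀ v w : V, (∀ V' (ξ : Module.Dual k (V ⧸ V'.1)), ξ (q V' v) = ξ (q V' w)) → v = w := by
    intro v w hvw
    refine sub_eq_zero.1 (IsPseudocompactModule.separated (k := k) (A := CGA k G) _ fun V' => ?_)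
    refine (mem_iff _ _).2 fun ξ => ?_
    rw [map_sub, map_sub, hvw, sub_self]
  have hadd : ∀ u v, ψ' (u + v) = ψ' u + ψ' v := fun u v => ext _ _ fun V' ξ => by
    rw [map_add, map_add, hψ', hψ', hψ']
    have := hb' (u + v, ξ ∘ₗ q V') (u, ξ ∘ₗ q V') (v, ξ ∘ₗ q V') 1 (by
      filter_upwards [Filter.eventually_le_atBot V'] with V'' hV
      change ξ (V'.1.mkQ _) = 1 * ξ (V'.1.mkQ _) + ξ (V'.1.mkQ _)
      rw [one_mul, htθ hV, htθ hV, htθ hV, map_add, map_add, map_add])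
    rwa [one_mul] at this
  have hsmul : ∀ (a : CGA k G) u, ψ' (a • u) = a • ψ' u := fun a u => ext _ _ fun V' ξ => by
    -- The action of `a` is shifted to the functional: `ξ ∘ a` again factors through `V ⧸ V'`. The
    -- pair `(u, 0)`, with limit `0`, fills the unused summand in `hb'`.
    have h1 := hψ' u V' (ξ ∘ₗ Algebra.lsmul k k (V ⧸ V'.1) a)
    refine Eq.trans ?_ h1.symm
    rw [hψ']
    have h0 := hb (u, 0) 0 (Filter.Eventually.of_forall fun V' => rfl)
    have := hb' (a • u, ξ ∘ₗ q V') (u, (ξ ∘ₗ Algebra.lsmul k k (V ⧸ V'.1) a) ∘ₗ q V') (u, 0) 1 (by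
      filter_upwards [Filter.eventually_le_atBot V'] with V'' hV
      change ξ (V'.1.mkQ _) = 1 * ξ (a • V'.1.mkQ _) + 0
      rw [one_mul, add_zero, htθ hV, htθ hV, map_smul, map_smul])
    rwa [one_mul, h0, add_zero] at this
  have hcont : ∀ V' : OpenFinSubmodule k (CGA k G) V, ∀ᶠ u in nhds (0 : U), ψ' u ∈ V'.1 := by
    intro V'
    let I := Module.annihilator (CGA k G) (V ⧸ V'.1)
    -- The closure of `I U` does not depend on the approximate lifts, each of which sends it to zero
    -- modulo `V'`. Finite generation of `U` gives it finite codimension, so it is open.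
    let C : Submodule (CGA k G) U :=
      (Submodule.span (CGA k G) {x : U | ∃ a ∈ I, ∃ u : U, x = a • u}).topologicalClosure
    have : Module.Finite k (CGA k G ⧸ I) := CGA.finite_quotient (isOpen_annihilator k V')
    have hfin : Module.Finite k (U ⧸ C) := finite_quotient_of_smul_mem I C fun a ha u =>
      subset_closure (Submodule.subset_span ⟨a, ha, u, rfl⟩)
    have hC : IsOpen (C : Set U) :=
      C.isOpen_of_isClosed_of_finite (k := k) (Submodule.isClosed_topologicalClosure _)
    filter_upwards [hC.mem_nhds C.zero_mem] with u hu
    refine (mem_iff _ _).2 fun ξ => ?_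
    rw [hψ']
    refine hb _ _ ?_
    filter_upwards [Filter.eventually_le_atBot V'] with V'' hV
    have : DiscreteTopology (V ⧸ V''.1) := V''.1.discreteTopology_quotient V''.2.1
    have : DiscreteTopology (V ⧸ V'.1) := V'.1.discreteTopology_quotient V'.2.1
    let f : U →L[CGA k G] V ⧸ V'.1 :=
      (⟨Submodule.factor hV, continuous_of_discreteTopology⟩ : (V ⧸ V''.1) →L[CGA k G] V ⧸ V'.1).comp
        (θ V'')
    have hf : C ≤ LinearMap.ker (f : U →ₗ[CGA k G] V ⧸ V'.1) := by
      refine Submodule.topologicalClosure_minimal _ (Submodule.span_le.2 ?_) ?_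
      · rintro _ ⟨a, ha, u, rfl⟩
        exact LinearMap.mem_ker.2 ((map_smul f a u).trans (Module.mem_annihilator.1 ha _))
      · exact isClosed_eq f.continuous continuous_const
    change ξ (V'.1.mkQ _) = 0
    rw [htθ hV, show Submodule.factor hV (θ V'' u) = 0 from hf hu, map_zero]
  have hc : Continuous (AddMonoidHom.mk' ψ' hadd) := by
    refine continuous_of_continuousAt_zero _ ?_
    rw [ContinuousAt, map_zero,
      (IsPseudocompactModule.hasBasis (k := k) (A := CGA k G) (U := V)).tendsto_right_iff]
    exact fun V' hV' => hcont ⟨V', hV'⟩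
  refine ⟨⟨⟨⟨ψ', hadd⟩, hsmul⟩, hc⟩, fun u => ?_⟩
  change β (ψ' u) = φ u
  refine sub_eq_zero.1 (IsPseudocompactModule.separated (k := k) (A := CGA k G) _ fun W' => ?_)
  have := W'.2.2
  let g : V →ₗ[CGA k G] W ⧸ W'.1 := W'.1.mkQ ∘ₗ (β : V →ₗ[CGA k G] W)
  have hg : ∀ v, v ∈ LinearMap.ker g ↔ β v ∈ W'.1 := fun v =>
    Submodule.Quotient.mk_eq_zero W'.1
  have hgo : IsOpen (LinearMap.ker g : Set V) := by
    convert W'.2.1.preimage β.continuous using 1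
    ext v
    exact hg v
  -- With `V'` the preimage of `W'`, every `V'' ≤ V'` satisfies `V'' + ker β ≤ V'`. So `t V'' u` and
  -- `ψ u` agree modulo `V'`, and the limit is taken over an eventually constant family.
  let V' : OpenFinSubmodule k (CGA k G) V := ⟨LinearMap.ker g, hgo, finite_quotient_ker k g⟩
  rw [← hβ, ← map_sub]
  refine (hg _).1 ((mem_iff V' _).2 fun ξ => ?_)
  rw [map_sub, map_sub, hψ', sub_eq_zero]
  refine hb _ _ ?_
  filter_upwards [Filter.eventually_le_atBot V'] with V'' hV
  rw [LinearMap.comp_apply, ← sub_eq_zero, ← map_sub, ← map_sub]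
  refine (mem_iff V' _).1 (?_ : _ ∈ LinearMap.ker g) ξ
  have hsup : V''.1 ⊔ LinearMap.ker (β : V →ₗ[CGA k G] W) ≤ LinearMap.ker g := by
    refine sup_le hV fun v hv => (hg v).2 ?_
    rw [show β v = 0 from hv]
    exact W'.1.zero_mem
  exact hsup (hθ V'' u (t V'' u) (ht _ _))

theorem relProjective_of_coinvariants [IsTopologicalGroup G] [CompactSpace G]
    [IsPseudocompactModule k (CGA k G) U] [Module.Finite (CGA k G) U] (H : Subgroup G)
    (h : ∀ N : OpenNormalSubgroup G,
      RelProjective k (H ⊔ N.toSubgroup) (Coinvariants k N.toSubgroup U)) :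
    RelProjective k H U := by
  intro V W _ _ _ _ _ _ _ _ _ _ _ _ _ _ _ _ β φ _ ⟨ψ, hψ⟩
  obtain ⟨θ, hθ, hH, he⟩ := Res.exists_linearMap ψ
  have hβ : ∀ u, β (θ u) = φ u := fun u => by
    rw [he]
    exact hψ u
  exact exists_lift_of_exists_lift_mod (k := k) β φ θ hβ (exists_lift_mod H h β φ θ hθ hH hβ)

end Lifting

theorem mainTheorem10 {k G : Type u} [Field k] [Group G] [TopologicalSpace G]
    [IsTopologicalGroup G] [CompactSpace G] [TotallyDisconnectedSpace G]
    (H : Subgroup G) (hH : IsClosed (H : Set G))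
    (U : Type u) [AddCommGroup U] [Module k U] [Module (CGA k G) U]
    [IsScalarTower k (CGA k G) U] [TopologicalSpace U] [IsTopologicalAddGroup U]
    [ContinuousSMul (CGA k G) U] [IsPseudocompactModule k (CGA k G) U]
    [Module.Finite (CGA k G) U] :
    List.TFAE [
      RelProjective k H U,
      ∀ (V : Type u) [AddCommGroup V] [Module k V] [Module (CGA k G) V]
        [IsScalarTower k (CGA k G) V] [TopologicalSpace V] [IsTopologicalAddGroup V]
        [ContinuousSMul (CGA k G) V] [IsPseudocompactModule k (CGA k G) V]
        (π : V →L[CGA k G] U), Function.Surjective π → SplitsOver k H π → Splits π,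
      IsSummand (CGA k G) U (Ind k H (Res k H U)),
      Splits (naturalProj k H U),
      ∃ (X : Type u) (_ : AddCommGroup X) (_ : Module k X) (_ : Module (CGA k H) X)
        (_ : IsScalarTower k (CGA k H) X) (_ : TopologicalSpace X)
        (_ : IsTopologicalAddGroup X) (_ : ContinuousSMul (CGA k H) X)
        (_ : IsPseudocompactModule k (CGA k H) X), IsSummand (CGA k G) U (Ind k H X),
      ∀ N : OpenNormalSubgroup G, RelProjective k (H ⊔ N.toSubgroup) U,
      ∀ N : OpenNormalSubgroup G,
        RelProjective k (H ⊔ N.toSubgroup) (Coinvariants k N.toSubgroup U),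
      ∀ N : OpenNormalSubgroup G,
        ∃ α : Res k (H ⊔ N.toSubgroup) U →L[CGA k ↥(H ⊔ N.toSubgroup)]
            Res k (H ⊔ N.toSubgroup) U,
          ∀ u : U, traceMap k (H ⊔ N.toSubgroup) α u = u] := by
  -- Stated for an arbitrary subgroup because it is applied to `HN`.
  have split_of_rel : ∀ K : Subgroup G, RelProjective k K U → Splits (naturalProj k K U) :=
    fun K h => h.splits _ (naturalProj k K U) naturalProj_surjective splitsOver_naturalProj
  tfae_have 1 → 2 := fun h V => h.splits V
  tfae_have 2 → 4 := fun h =>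
    h _ (naturalProj k H U) naturalProj_surjective splitsOver_naturalProj
  tfae_have 4 → 3 := fun h => h.isSummand
  tfae_have 3 → 5 := fun h => ⟨Res k H U, inferInstance, inferInstance, inferInstance,
    inferInstance, inferInstance, inferInstance, inferInstance, inferInstance, h⟩
  tfae_have 5 → 1 := fun ⟨_, _, _, _, _, _, _, _, _, h⟩ => h.relProjective
  tfae_have 1 → 6 := fun h N => h.mono le_sup_left
  tfae_have 6 → 8 := fun h N =>
    exists_traceMap_eq_self (H ⊔ N.toSubgroup) N le_sup_right (split_of_rel _ (h N))
  tfae_have 8 → 7 := fun h N => by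
    obtain ⟨α, hα⟩ := h N
    have : Finite (G ⧸ (H ⊔ N.toSubgroup)) := Subgroup.quotient_finite_of_isOpen _
      (Subgroup.isOpen_mono le_sup_right N.isOpen')
    exact relProjective_coinvariants_of_trace N.toSubgroup le_sup_right α hα
  tfae_have 7 → 1 := relProjective_of_coinvariants H
  tfae_finish
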